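/- Let $n\ge 1$, $d\ge 2$, $0\le p\le 1$, and let $a_{si}\in\mathbb C$ ($1\le s\le n$, $1\le i\le d-1$) satisfy $\sum_{s,i}|a_{si}|^2=1$. Consider the $n$-qudit state (a generalized $W$-class state superposed with the vacuum, "GWV state") $$|\psi\rangle_{A_1\cdots A_n}=\sqrt p\,\sum_{i=1}^{d-1}\bigl(a_{1i}|i0\cdots0\rangle+a_{2i}|0i\cdots 0\rangle+\cdots+a_{ni}|0\cdots0i\rangle\bigr)+\sqrt{1-p}\,|0\cdots0\rangle .$$ Let $r\ge 3$ and let $P,P_0,\dots,P_{r-1}$ be pairwise disjoint non-empty subsets of $\{A_1,\dots,A_n\}$, that is, a partition of some set of qudits. For disjoint sets $S,T$ of qudits let $\rho_{S|T}$ denote the reduced density matrix of $|\psi\rangle\langle\psi|$ on the qudits of $S\cup T$, viewed as a bipartite state with parts $S$ and $T$; write $\rho_{PP_j}$ for $\rho_{P|P_j}$ and $\rho_{P|P_i\cdots P_{r-1}}$ for $\rho_{P|P_i\cup\cdots\cup P_{r-1}}$. For $\alpha>0$ the Rényi-$\alpha$ entanglement of a bipartite pure state is $E_\alpha(|\phi\rangle_{AB})=S_\alpha(\mathrm{tr}_B|\phi\rangle\langle\phi|)$,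 where $S_\alpha(\rho)=\frac1{1-\alpha}\log_2\mathrm{tr}\,\rho^\alpha$ for $\alpha\ne1$ and $S_1(\rho)=-\mathrm{tr}\,\rho\log_2\rho$, and that of a bipartite mixed state is $E_\alpha(\rho_{AB})=\min\sum_l q_lE_\alpha(|\phi_l\rangle)$, the minimum being over all decompositions $\rho_{AB}=\sum_l q_l|\phi_l\rangle\langle\phi_l|$ into pure states. Let $\alpha\ge\frac{\sqrt7-1}2$, $\beta\ge2$, $0<k\le1$, let $t$ be an integer with $0\le t\le r-3$, and put $\mathcal K_\beta=\frac{(1+k)^{\beta/2}-1}{k^{\beta/2}}$. Suppose that $$k\,E_\alpha^2(\rho_{PP_i})\ge E_\alpha^2(\rho_{P|P_{i+1}\cdots P_{r-1}})\quad\text{for } i=0,1,\dots,t,$$ $$E_\alpha^2(\rho_{PP_j})\le k\,E_\alpha^2(\rho_{P|P_{j+1}\cdots P_{r-1}})\quad\text{for } j=t+1,\dots,r-2 .$$ Then $$E_\alpha^\beta(\rho_{P|P_0\cdots P_{r-1}})\ \ge\ \sum_{j=0}^{t}\mathcal K_\beta^{\,j}\,E_\alpha^\beta(\rho_{PP_j})+\mathcal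 K_\beta^{\,t+2}\sum_{j=t+1}^{r-2}E_\alpha^\beta(\rho_{PP_j})+\mathcal K_\beta^{\,t+1}E_\alpha^\beta(\rho_{PP_{r-1}}).$$ -/

import Mathlib

/-! Generalized W-class states superposed with the vacuum, their reduced density matrices, and the
Rényi entanglement of bipartite mixed states. -/

noncomputable section

namespace GWVState

open Finset

section Entanglement

/-- The marginal on the first factor, `ρ_A = tr_B |φ⟩⟨φ|`, of a vector `φ` of `ℂ^A ⊗ ℂ^B`
(given by its coordinates in the product basis). -/
def marginal {A B : Type} [Fintype B] (φ : A × B → ℂ) : Matrix A A ℂ :=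
  Matrix.of fun a a' => ∑ b, φ (a, b) * star (φ (a', b))

theorem marginal_isHermitian {A B : Type} [Fintype B] (φ : A × B → ℂ) :
    (marginal φ).IsHermitian := by
  ext a a'
  simp [marginal, mul_comm]

variable {A B : Type} [Fintype A] [DecidableEq A] [Fintype B]

/-- The Rényi entropy `S_α(ρ) = (1 - α)⁻¹ log₂ tr ρ^α` of a density matrix, where
`tr ρ^α` is the sum of the `α`-th powers of the eigenvalues; for `α = 1` it is the
von Neumann entropy `- tr ρ log₂ ρ`. -/
def renyiEntropy (α : ℝ) {ρ : Matrix A A ℂ} (hρ : ρ.IsHermitian) : ℝ :=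
  if α = 1 then - ∑ i, hρ.eigenvalues i * Real.logb 2 (hρ.eigenvalues i)
  else 1 / (1 - α) * Real.logb 2 (∑ i, hρ.eigenvalues i ^ α)

/-- The Rényi-`α` entanglement of a bipartite pure state. -/
def pureEntanglement (α : ℝ) (φ : A × B → ℂ) : ℝ :=
  renyiEntropy α (marginal_isHermitian φ)

/-- `ρ = ∑ k, q k |φ k⟩⟨φ k|` is a decomposition of `ρ` as a convex combination of
(normalized) pure states. -/
def IsPureDecomposition (ρ : Matrix (A × B) (A × B) ℂ) {m : ℕ} (q : Fin m → ℝ)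
    (φ : Fin m → A × B → ℂ) : Prop :=
  (∀ k, 0 ≤ q k) ∧ ∑ k, q k = 1 ∧ (∀ k, ∑ x, ‖φ k x‖ ^ 2 = 1) ∧
    ρ = ∑ k, (q k : ℂ) • Matrix.vecMulVec (φ k) (star (φ k))

/-- The Rényi-`α` entanglement of a bipartite mixed state: the minimal average entanglement over
all pure state decompositions (convex roof). -/
def renyiEntanglement (α : ℝ) (ρ : Matrix (A × B) (A × B) ℂ) : ℝ :=
  sInf {e : ℝ | ∃ (m : ℕ) (q : Fin m → ℝ) (φ : Fin m → A × B → ℂ),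
    IsPureDecomposition ρ q φ ∧ e = ∑ k, q k * pureEntanglement α (φ k)}

end Entanglement

section States

variable {n d : ℕ}

/-- The generalized `W`-class vector `∑ s, ∑ i ≠ 0, a s i |0 … i … 0⟩` of `n` qudits of dimension
`d`, with the excitation `i` at site `s`. The values `a s 0` are not used. -/
def genW [NeZero d] (a : Fin n → Fin d → ℂ) : (Fin n → Fin d) → ℂ :=
  fun x => ∑ s, ∑ i with i ≠ 0, if x = Pi.single s i then a s i else 0

/-- The superposition `√p |W⟩ + √(1 - p) |0 … 0⟩` of a generalized `W`-class state and the
vacuum. -/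
def gwv [NeZero d] (p : ℝ) (a : Fin n → Fin d → ℂ) : (Fin n → Fin d) → ℂ :=
  fun x => (√p : ℂ) * genW a x + (√(1 - p) : ℂ) * (if x = 0 then 1 else 0)

/-- The basis configurations of the qudits in `S`. -/
abbrev Config (d : ℕ) (S : Finset (Fin n)) : Type := {s // s ∈ S} → Fin d

/-- The configuration of all `n` qudits that is `x` on `S`, `y` on `T` and `z` elsewhere
(for disjoint `S` and `T`). -/
def glue (S T : Finset (Fin n)) (x : Config d S) (y : Config d T)
    (z : {s // s ∉ S ∪ T} → Fin d) : Fin n → Fin d :=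
  fun s =>
    if hS : s ∈ S then x ⟨s, hS⟩
    else if hT : s ∈ T then y ⟨s, hT⟩
    else z ⟨s, by simp [hS, hT]⟩

/-- The reduced density matrix `ρ_{S|T}` of the pure state `ψ` on the qudits in `S ∪ T`, for
disjoint `S` and `T`, as a state of the bipartite system with parts `S` and `T`: the other qudits
are traced out. -/
def reducedState (ψ : (Fin n → Fin d) → ℂ) (S T : Finset (Fin n)) :
    Matrix (Config d S × Config d T) (Config d S × Config d T) ℂ :=
  Matrix.of fun x y => ∑ z : {s // s ∉ S ∪ T} → Fin d,
    ψ (glue S T x.1 x.2 z) * star (ψ (glue S T y.1 y.2 z))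

/-- The Rényi-`α` entanglement `E_α(ρ_{S|T})` of the reduced state of `ψ` across `S | T`. -/
def entanglement (α : ℝ) (ψ : (Fin n → Fin d) → ℂ) (S T : Finset (Fin n)) : ℝ :=
  renyiEntanglement α (reducedState ψ S T)

end States

/-- The weight `K_β = ((1 + k)^(β/2) - 1) / k^(β/2)`. -/
def weight (k β : ℝ) : ℝ := ((1 + k) ^ (β / 2) - 1) / k ^ (β / 2)

end GWVState

end

/-! Every basis state in the superposition has at most one excited site. Tracing out the sites
outside `S ∪ T` therefore leaves `|v⟩⟨v| + c |00⟩⟨00|`, where `v` never excites both `S` and `T`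
(`reducedState_eq_addVacuum`). In any pure decomposition the off-vacuum part of the `k`-th vector is
`x k • v`, with `∑ q k ‖x k‖² = 1`. Its marginal has rank at most two, and its concurrence is `‖x
k‖² C` with `C = 2 √(w_S w_T)`, where `w` is the excitation weight. So the average concurrence is
`C` for every decomposition. The entanglement of each vector is `concurrenceRenyi α` of its
concurrence. Once this function is convex on `[0, 1]`, Jensen bounds every average below by its
value at `C`, and two equiprobable states attain it.

Convexity is where `(√7 - 1) / 2` enters. With `x = 1 / cosh u` the derivative becomes a hyperbolic
quotient, whose monotonicity reduces to the sign of a power series in `u`. With `c = 2 α - 1`, each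
coefficient is concave in `c` and vanishes at `c = 1`; the cubic one also vanishes at `c = √7 - 2`.

The squared concurrence `4 w_S w_T` is additive in `T`, so convexity and vanishing at `0` give
monogamy of the squared entanglement. If the smaller square is at most `k` times the larger, raising
to the power `β / 2` puts the factor `weight k β` on the smaller term. Iterating over the tails `Q m
∪ ⋯ ∪ Q (r - 1)` gives the result. -/

noncomputable section

namespace GWVState

/-! ### Sign of a hyperbolic expression through its Taylor coefficients. -/

section HyperbolicInequality

/-- `4 / m!` times this is the coefficient of `u ^ m`, `m` odd, in the power series of
`sinh u - sinh (c u) - (cosh (c u) - c cosh u) sinh u cosh u`. -/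
def sinhCoeff (m : ℕ) (c : ℝ) : ℝ :=
  4 + c - 4 * c ^ m - (2 + c) ^ m - (2 - c) ^ m + c * 3 ^ m

theorem concaveOn_sinhCoeff (j : ℕ) : ConcaveOn ℝ (Set.Ici 0) (sinhCoeff (2 * j + 1)) := by
  have hd (c : ℝ) : HasDerivAt (sinhCoeff (2 * j + 1))
      (1 - 4 * ((2 * j + 1) * c ^ (2 * j)) - (2 * j + 1) * (2 + c) ^ (2 * j)
        + (2 * j + 1) * (2 - c) ^ (2 * j) + 3 ^ (2 * j + 1)) c := by
    have h1 := (hasDerivAt_id c).const_add 4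
    have h2 := ((hasDerivAt_id c).pow (2 * j + 1)).const_mul 4
    have h3 := ((hasDerivAt_id c).const_add 2).pow (2 * j + 1)
    have h4 := ((hasDerivAt_id c).const_sub 2).pow (2 * j + 1)
    have h5 := (hasDerivAt_id c).mul_const ((3 : ℝ) ^ (2 * j + 1))
    refine (((((h1.sub h2).sub h3).sub h4).add h5)).congr_deriv ?_
    simp
  have hd2 (c : ℝ) : HasDerivAt (fun c : ℝ ↦
      (1 - 4 * ((2 * j + 1) * c ^ (2 * j)) - (2 * j + 1) * (2 + c) ^ (2 * j)
        + (2 * j + 1) * (2 - c) ^ (2 * j) + 3 ^ (2 * j + 1)))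
      (-((2 * j + 1) * (2 * j) * (4 * c ^ (2 * j - 1) + (2 + c) ^ (2 * j - 1)
        + (2 - c) ^ (2 * j - 1)))) c := by
    have h2 := (((hasDerivAt_id c).pow (2 * j)).const_mul (2 * j + 1 : ℝ)).const_mul 4
    have h3 := (((hasDerivAt_id c).const_add 2).pow (2 * j)).const_mul (2 * j + 1 : ℝ)
    have h4 := (((hasDerivAt_id c).const_sub 2).pow (2 * j)).const_mul (2 * j + 1 : ℝ)
    refine (((((h2.const_sub 1).sub h3).add h4)).add_const _).congr_deriv ?_
    simp
    ring
  refine concaveOn_of_hasDerivWithinAt2_nonpos (convex_Ici 0)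
    (fun c _ ↦ (hd c).continuousAt.continuousWithinAt) (fun c _ ↦ (hd c).hasDerivWithinAt)
    (fun c _ ↦ (hd2 c).hasDerivWithinAt) fun c hc ↦ ?_
  rw [interior_Ici, Set.mem_Ioi] at hc
  rcases Nat.eq_zero_or_pos j with rfl | hj
  · simp
  -- For `c > 2` the power of `2 - c` is negative; by oddness it is absorbed by the power of `2 +
  -- c`.
  have hodd : Odd (2 * j - 1) := ⟨j - 1, by omega⟩
  have h1 : (c - 2) ^ (2 * j - 1) ≤ (2 + c) ^ (2 * j - 1) := hodd.strictMono_pow.monotone (by linarith)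
  have h2 : (2 - c) ^ (2 * j - 1) = -(c - 2) ^ (2 * j - 1) := by rw [← hodd.neg_pow]; simp
  have h3 : 0 ≤ 4 * c ^ (2 * j - 1) + (2 + c) ^ (2 * j - 1) + (2 - c) ^ (2 * j - 1) := by
    rw [h2]
    have : 0 ≤ c ^ (2 * j - 1) := by positivity
    linarith
  have : (0 : ℝ) ≤ (2 * j + 1) * (2 * j) := by positivity
  nlinarith [mul_nonneg this h3]

theorem sqrt_seven_bounds : 2.645 ≤ √7 ∧ √7 ≤ 2.646 :=
  ⟨Real.le_sqrt_of_sq_le (by norm_num), Real.sqrt_le_iff.2 ⟨by norm_num, by norm_num⟩⟩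

theorem sinhCoeff_one (m : ℕ) : sinhCoeff m 1 = 0 := by
  norm_num [sinhCoeff]

/-- For exponent `1` the coefficient is identically zero, and for `3` it is `-4 (c - 1) (c² + 4 c -
3)`, with root `√7 - 2`. From `5` on the term `c * 3 ^ m` dominates. -/
theorem sinhCoeff_sqrt_seven_sub_two_nonneg (j : ℕ) : 0 ≤ sinhCoeff (2 * j + 1) (√7 - 2) := by
  obtain ⟨h1, h2⟩ := sqrt_seven_bounds
  have hs : √7 ^ 2 = 7 := Real.sq_sqrt (by norm_num)
  match j with
  | 0 => norm_num [sinhCoeff]; linarith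
  | 1 => norm_num [sinhCoeff]; ring_nf; nlinarith [hs, show √7 ^ 3 = 7 * √7 by rw [pow_succ, hs]]
  | j + 2 =>
    -- Raising the exponent by two multiplies the left side by at most `7` and the right side by
    -- `9`. The remaining terms `4 + c - 4 c ^ m` are nonnegative because `0 ≤ c ≤ 1`.
    have key : √7 ^ (2 * (j + 2) + 1) + (4 - √7) ^ (2 * (j + 2) + 1)
        ≤ (√7 - 2) * 3 ^ (2 * (j + 2) + 1) := by
      induction j with
      | zero =>
        have e1 : √7 ^ 5 = 49 * √7 := by
          rw [show √7 ^ 5 = (√7 ^ 2) ^ 2 * √7 by ring, hs]; norm_num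
        have e2 : (4 - √7) ^ 5 ≤ 1.355 ^ 5 := pow_le_pow_left₀ (by linarith) (by linarith) _
        norm_num [e1] at e2 ⊢
        linarith
      | succ j ih =>
        have e1 : √7 ^ (2 * (j + 1 + 2) + 1) = 7 * √7 ^ (2 * (j + 2) + 1) := by
          rw [show √7 ^ (2 * (j + 1 + 2) + 1) = √7 ^ 2 * √7 ^ (2 * (j + 2) + 1) by ring, hs]
        have e2 : (4 - √7) ^ (2 * (j + 1 + 2) + 1)
            = (4 - √7) ^ 2 * (4 - √7) ^ (2 * (j + 2) + 1) := by ring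
        have e3 : (4 - √7) ^ 2 ≤ 7 := by nlinarith
        have p1 : 0 ≤ (4 - √7) ^ (2 * (j + 2) + 1) := pow_nonneg (by linarith) _
        have p2 : 0 ≤ √7 ^ (2 * (j + 2) + 1) := by positivity
        have e4 : (3 : ℝ) ^ (2 * (j + 1 + 2) + 1) = 9 * 3 ^ (2 * (j + 2) + 1) := by ring
        rw [e1, e2, e4]
        nlinarith [mul_le_mul_of_nonneg_right e3 p1]
    have hc : (√7 - 2) ^ (2 * (j + 2) + 1) ≤ 1 := pow_le_one₀ (by linarith) (by linarith)
    unfold sinhCoeff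
    rw [show 2 + (√7 - 2) = √7 by ring, show 2 - (√7 - 2) = 4 - √7 by ring]
    linarith

theorem sinhCoeff_nonneg (j : ℕ) {c : ℝ} (h1 : √7 - 2 ≤ c) (h2 : c ≤ 1) :
    0 ≤ sinhCoeff (2 * j + 1) c := by
  have hs := sqrt_seven_bounds
  have := (concaveOn_sinhCoeff j).ge_on_segment (x := √7 - 2) (y := 1) (z := c)
    (by simp; linarith) (by simp) (by rw [segment_eq_Icc (by linarith)]; exact ⟨h1, h2⟩)
  rw [sinhCoeff_one] at this
  exact (le_min (sinhCoeff_sqrt_seven_sub_two_nonneg j) le_rfl).trans this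

theorem sinhCoeff_nonpos (j : ℕ) {c : ℝ} (h : 1 ≤ c) : sinhCoeff (2 * j + 1) c ≤ 0 := by
  have hs := sqrt_seven_bounds
  rcases h.eq_or_lt with rfl | h
  · rw [sinhCoeff_one]
  -- The chord from `√7 - 2` to `1` has nonpositive slope, so by concavity the values beyond `1`
  -- stay at or below zero.
  have := (concaveOn_sinhCoeff j).slope_anti_adjacent (x := √7 - 2) (y := 1) (z := c)
    (by simp; linarith) (by simp; linarith) (by linarith) h
  rw [sinhCoeff_one, div_le_div_iff₀ (by linarith) (by linarith)] at this
  have h0 := sinhCoeff_sqrt_seven_sub_two_nonneg j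
  have : sinhCoeff (2 * j + 1) c * (1 - (√7 - 2)) ≤ 0 := by nlinarith
  exact nonpos_of_mul_nonpos_left this (by linarith)

/-- The numerator of the derivative of `u ↦ sinh ((1 - α) u) cosh u / (sinh u cosh (α u))`,
up to the factor `-1/2`, where `c = 2 α - 1`. -/
def sinhDefect (c u : ℝ) : ℝ :=
  Real.sinh u - Real.sinh (c * u)
    - (Real.cosh (c * u) - c * Real.cosh u) * (Real.sinh u * Real.cosh u)

theorem hasSum_sinhDefect (c u : ℝ) :
    HasSum (fun j : ℕ ↦ sinhCoeff (2 * j + 1) c * (u ^ (2 * j + 1) / (2 * j + 1).factorial))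
      (4 * sinhDefect c u) := by
  have h (b : ℝ) : HasSum (fun j : ℕ ↦ b ^ (2 * j + 1) * (u ^ (2 * j + 1) / (2 * j + 1).factorial))
      (Real.sinh (b * u)) := by
    simpa only [mul_pow, mul_div_assoc] using Real.hasSum_sinh (b * u)
  have := ((((((h 1).mul_left (4 + c)).sub ((h c).mul_left 4)).sub (h (2 + c))).sub
    (h (2 - c))).add ((h 3).mul_left c))
  have hval : 4 * sinhDefect c u = (4 + c) * Real.sinh (1 * u) - 4 * Real.sinh (c * u)
      - Real.sinh ((2 + c) * u) - Real.sinh ((2 - c) * u) + c * Real.sinh (3 * u) := by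
    unfold sinhDefect
    rw [show (2 + c) * u = u + u + c * u by ring, show (2 - c) * u = u + u - c * u by ring,
      show 3 * u = u + u + u by ring, one_mul]
    simp only [Real.sinh_add, Real.sinh_sub, Real.cosh_add]
    linear_combination (c * Real.sinh u) * Real.cosh_sq u
  rw [hval]
  refine Eq.mp (congrArg (HasSum · _) (funext fun j ↦ ?_)) this
  simp only [sinhCoeff]
  ring

theorem sinhDefect_nonneg {c u : ℝ} (h1 : √7 - 2 ≤ c) (h2 : c ≤ 1) (hu : 0 ≤ u) :
    0 ≤ sinhDefect c u := by
  have := (hasSum_sinhDefect c u).nonneg fun j ↦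
    mul_nonneg (sinhCoeff_nonneg j h1 h2) (by positivity)
  linarith

theorem sinhDefect_nonpos {c u : ℝ} (h : 1 ≤ c) (hu : 0 ≤ u) : sinhDefect c u ≤ 0 := by
  have := (hasSum_sinhDefect c u).nonpos fun j ↦
    mul_nonpos_of_nonpos_of_nonneg (sinhCoeff_nonpos j h) (by positivity)
  linarith

end HyperbolicInequality

/-! ### Convexity of the Rényi entropy as a function of the concurrence. -/

section Concurrence

/-- The Rényi-`α` entropy of the spectrum `{(1 ± √(1 - x ^ 2)) / 2}`, that is, the Rényi-`α`
entanglement of a bipartite pure state of Schmidt rank at most two and concurrence `x`. -/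
def concurrenceRenyi (α x : ℝ) : ℝ :=
  if α = 1 then
    -((1 + √(1 - x ^ 2)) / 2 * Real.logb 2 ((1 + √(1 - x ^ 2)) / 2)
      + (1 - √(1 - x ^ 2)) / 2 * Real.logb 2 ((1 - √(1 - x ^ 2)) / 2))
  else 1 / (1 - α) *
    Real.logb 2 (((1 + √(1 - x ^ 2)) / 2) ^ α + ((1 - √(1 - x ^ 2)) / 2) ^ α)

/-- `log 2` times `concurrenceRenyi α` at `(cosh u)⁻¹`, for `0 ≤ u`. -/
def hyperbolicRenyi (α u : ℝ) : ℝ :=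
  if α = 1 then Real.log (2 * Real.cosh u) - u * (Real.sinh u / Real.cosh u)
  else 1 / (1 - α) * (Real.log (2 * Real.cosh (α * u)) - α * Real.log (2 * Real.cosh u))

/-- The derivative of `hyperbolicRenyi α u` with respect to `(cosh u)⁻¹`. -/
def hyperbolicSlope (α u : ℝ) : ℝ :=
  if α = 1 then u / Real.sinh u
  else α / (1 - α) *
    (Real.sinh ((1 - α) * u) * Real.cosh u / (Real.cosh (α * u) * Real.sinh u))

/-- At `x = 1 / cosh u` the two eigenvalues are `(1 ± tanh u) / 2 = exp (± u) / (2 cosh u)`, so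
their `α`-th powers sum to `2 cosh (α u) / (2 cosh u) ^ α`. -/
theorem concurrenceRenyi_inv_cosh (α : ℝ) {u : ℝ} (hu : 0 ≤ u) :
    concurrenceRenyi α (Real.cosh u)⁻¹ = hyperbolicRenyi α u / Real.log 2 := by
  have hc := Real.cosh_pos u
  have hs : √(1 - (Real.cosh u)⁻¹ ^ 2) = Real.sinh u / Real.cosh u := by
    have hsq : 1 - (Real.cosh u)⁻¹ ^ 2 = (Real.sinh u / Real.cosh u) ^ 2 := by
      field_simp
      linear_combination Real.cosh_sq u
    rw [hsq, Real.sqrt_sq (div_nonneg (Real.sinh_nonneg_iff.2 hu) hc.le)]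
  have h1 : (1 + Real.sinh u / Real.cosh u) / 2 = Real.exp u / (2 * Real.cosh u) := by
    rw [← Real.cosh_add_sinh]; field_simp
  have h2 : (1 - Real.sinh u / Real.cosh u) / 2 = Real.exp (-u) / (2 * Real.cosh u) := by
    rw [← Real.cosh_sub_sinh]; field_simp
  have h2c : 0 < 2 * Real.cosh u := by positivity
  unfold concurrenceRenyi hyperbolicRenyi
  rw [hs, h1, h2]
  split_ifs with h
  · simp only [Real.logb]
    rw [Real.log_div (Real.exp_pos _).ne' h2c.ne', Real.log_div (Real.exp_pos _).ne' h2c.ne',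
      Real.log_exp, Real.log_exp, ← Real.cosh_add_sinh, ← Real.cosh_sub_sinh]
    field_simp
    ring
  · rw [Real.div_rpow (Real.exp_pos _).le h2c.le, Real.div_rpow (Real.exp_pos _).le h2c.le,
      ← Real.exp_mul, ← Real.exp_mul, ← add_div, neg_mul, mul_comm u α,
      show Real.exp (α * u) + Real.exp (-(α * u)) = 2 * Real.cosh (α * u) by
        rw [Real.cosh_eq]; ring,
      Real.logb, Real.log_div (by have := Real.cosh_pos (α * u); positivity) (by positivity),
      Real.log_rpow h2c]
    ring

theorem hasDerivAt_hyperbolicRenyi (α : ℝ) {u : ℝ} (hu : 0 < u) :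
    HasDerivAt (hyperbolicRenyi α)
      (hyperbolicSlope α u * (-(Real.sinh u / Real.cosh u ^ 2))) u := by
  have hc := Real.cosh_pos u
  have hca := Real.cosh_pos (α * u)
  have hs := Real.sinh_pos_iff.2 hu
  have hlog := ((Real.hasDerivAt_cosh u).const_mul 2).log (by positivity)
  unfold hyperbolicRenyi hyperbolicSlope
  split_ifs with h
  · have ht := (hasDerivAt_id u).mul ((Real.hasDerivAt_sinh u).div (Real.hasDerivAt_cosh u) hc.ne')
    refine (hlog.sub ht).congr_deriv ?_
    simp only [id, Pi.div_apply]
    field_simp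
    linear_combination (-u) * Real.cosh_sq u
  · have h1 : 1 - α ≠ 0 := sub_ne_zero.2 (Ne.symm h)
    have hla := (((hasDerivAt_id u).const_mul α).cosh.const_mul 2).log (by simp only [id]; positivity)
    refine ((hla.sub (hlog.const_mul α)).const_mul (1 / (1 - α))).congr_deriv ?_
    simp only [id]
    rw [sub_mul, one_mul, Real.sinh_sub]
    field_simp
    ring

theorem hasDerivAt_concurrenceRenyi (α : ℝ) {x : ℝ} (h0 : 0 < x) (h1 : x < 1) :
    HasDerivAt (concurrenceRenyi α) (hyperbolicSlope α (Real.arcosh x⁻¹) / Real.log 2) x := by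
  have hx : 1 < x⁻¹ := (one_lt_inv₀ h0).2 h1
  have hu := Real.arcosh_pos hx
  have hcomp := ((hasDerivAt_hyperbolicRenyi α hu).comp x
    ((Real.hasDerivAt_arcosh hx).comp x (hasDerivAt_inv h0.ne'))).div_const (Real.log 2)
  have heq : concurrenceRenyi α =ᶠ[nhds x]
      fun y ↦ (hyperbolicRenyi α ∘ (Real.arcosh ∘ fun y ↦ y⁻¹)) y / Real.log 2 := by
    filter_upwards [Ioo_mem_nhds h0 h1] with y hy
    have hy1 : 1 ≤ y⁻¹ := (one_le_inv₀ hy.1).2 hy.2.le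
    have := concurrenceRenyi_inv_cosh α (Real.arcosh_nonneg hy1)
    rw [Real.cosh_arcosh hy1, inv_inv] at this
    exact this
  refine (hcomp.congr_of_eventuallyEq heq).congr_deriv ?_
  have hs : 0 < Real.sinh (Real.arcosh x⁻¹) := Real.sinh_pos_iff.2 hu
  rw [← Real.sinh_arcosh hx.le, Real.cosh_arcosh hx.le]
  have hne := hs.ne'
  generalize Real.arcosh x⁻¹ = u at hne ⊢
  field_simp

theorem hasDerivAt_sinh_div (α : ℝ) {u : ℝ} (hu : 0 < u) :
    HasDerivAt (fun u ↦ Real.sinh ((1 - α) * u) * Real.cosh u / (Real.cosh (α * u) * Real.sinh u))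
      (-(sinhDefect (2 * α - 1) u / 2) / (Real.cosh (α * u) * Real.sinh u) ^ 2) u := by
  have hca := Real.cosh_pos (α * u)
  have hs := Real.sinh_pos_iff.2 hu
  have hN := ((hasDerivAt_id u).const_mul (1 - α)).sinh.mul (Real.hasDerivAt_cosh u)
  have hD := ((hasDerivAt_id u).const_mul α).cosh.mul (Real.hasDerivAt_sinh u)
  refine (hN.div hD (mul_pos hca hs).ne').congr_deriv ?_
  congr 1
  simp only [id, sinhDefect, Pi.mul_apply]
  -- Everything is expressed in the angles `α u` and `(1 - α) u`, whose sum is `u` and whose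
  -- difference is `(2 α - 1) u`.
  rw [show (2 * α - 1) * u = α * u - (1 - α) * u by ring, Real.sinh_sub, Real.cosh_sub]
  have hS : Real.sinh u = Real.sinh (α * u) * Real.cosh ((1 - α) * u)
      + Real.cosh (α * u) * Real.sinh ((1 - α) * u) := by rw [← Real.sinh_add]; ring_nf
  have hC : Real.cosh u = Real.cosh (α * u) * Real.cosh ((1 - α) * u)
      + Real.sinh (α * u) * Real.sinh ((1 - α) * u) := by rw [← Real.cosh_add]; ring_nf
  linear_combination (-(Real.sinh ((1 - α) * u) * Real.cosh (α * u))) * Real.cosh_sq u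
    + (1 / 2) * hS + (2 * α - 1) / 2 * Real.sinh u * Real.cosh u * hC

theorem sinh_le_mul_cosh {u : ℝ} (hu : 0 ≤ u) : Real.sinh u ≤ u * Real.cosh u := by
  have hd (v : ℝ) : HasDerivAt (fun v ↦ Real.sinh v - v * Real.cosh v) (-(v * Real.sinh v)) v := by
    refine ((Real.hasDerivAt_sinh v).sub
      ((hasDerivAt_id v).mul (Real.hasDerivAt_cosh v))).congr_deriv ?_
    simp
  have hanti : AntitoneOn (fun v ↦ Real.sinh v - v * Real.cosh v) (Set.Ici 0) := by
    refine antitoneOn_of_hasDerivWithinAt_nonpos (convex_Ici 0)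
      (fun v _ ↦ (hd v).continuousAt.continuousWithinAt)
      (fun v _ ↦ (hd v).hasDerivWithinAt) fun v hv ↦ ?_
    have hv : 0 ≤ v := interior_subset hv
    exact neg_nonpos.2 (mul_nonneg hv (Real.sinh_nonneg_iff.2 hv))
  have := hanti (Set.mem_Ici.2 le_rfl) (Set.mem_Ici.2 hu) hu
  simpa using this

theorem antitoneOn_hyperbolicSlope {α : ℝ} (hα : (√7 - 1) / 2 ≤ α) :
    AntitoneOn (hyperbolicSlope α) (Set.Ioi 0) := by
  have hα0 : 0 < α := by linarith [sqrt_seven_bounds.1]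
  rcases eq_or_ne α 1 with rfl | h
  · have hd {u : ℝ} (hu : 0 < u) : HasDerivAt (hyperbolicSlope 1)
        ((Real.sinh u - u * Real.cosh u) / Real.sinh u ^ 2) u := by
      have := (hasDerivAt_id u).div (Real.hasDerivAt_sinh u) (Real.sinh_pos_iff.2 hu).ne'
      rw [show hyperbolicSlope 1 = id / Real.sinh by ext v; simp [hyperbolicSlope]]
      simpa using this
    refine antitoneOn_of_hasDerivWithinAt_nonpos (convex_Ioi 0)
      (fun u hu ↦ (hd hu).continuousAt.continuousWithinAt)
      (fun u hu ↦ (hd (interior_subset hu)).hasDerivWithinAt) fun u hu ↦ ?_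
    have hu : 0 < u := interior_subset hu
    exact div_nonpos_of_nonpos_of_nonneg (sub_nonpos.2 (sinh_le_mul_cosh hu.le)) (sq_nonneg _)
  · have hd {u : ℝ} (hu : 0 < u) : HasDerivAt (hyperbolicSlope α)
        (α / (1 - α) * (-(sinhDefect (2 * α - 1) u / 2) / (Real.cosh (α * u) * Real.sinh u) ^ 2))
        u := by
      unfold hyperbolicSlope
      simpa only [h, if_false] using (hasDerivAt_sinh_div α hu).const_mul (α / (1 - α))
    refine antitoneOn_of_hasDerivWithinAt_nonpos (convex_Ioi 0)
      (fun u hu ↦ (hd hu).continuousAt.continuousWithinAt)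
      (fun u hu ↦ (hd (interior_subset hu)).hasDerivWithinAt) fun u hu ↦ ?_
    have hu : 0 < u := interior_subset hu
    -- The prefactor and the defect change sign together at `α = 1`.
    have hsign : 0 ≤ 1 / (1 - α) * sinhDefect (2 * α - 1) u := by
      rcases h.lt_or_gt with h | h
      · exact mul_nonneg (one_div_nonneg.2 (by linarith))
          (sinhDefect_nonneg (by linarith) (by linarith) hu.le)
      · exact mul_nonneg_of_nonpos_of_nonpos (one_div_nonpos.2 (by linarith))
          (sinhDefect_nonpos (by linarith) hu.le)
    have : α / (1 - α) * (-(sinhDefect (2 * α - 1) u / 2) / (Real.cosh (α * u) * Real.sinh u) ^ 2)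
        = -(α / 2 * (1 / (1 - α) * sinhDefect (2 * α - 1) u)
          / (Real.cosh (α * u) * Real.sinh u) ^ 2) := by ring
    rw [this, neg_nonpos]
    positivity

theorem continuous_concurrenceRenyi {α : ℝ} (hα : 0 < α) : Continuous (concurrenceRenyi α) := by
  have h1 : Continuous fun x : ℝ ↦ (1 + √(1 - x ^ 2)) / 2 := by fun_prop
  have h2 : Continuous fun x : ℝ ↦ (1 - √(1 - x ^ 2)) / 2 := by fun_prop
  unfold concurrenceRenyi
  split_ifs with h
  · simp only [Real.logb, ← mul_div_assoc]
    exact (((Real.continuous_mul_log.comp h1).div_const _).add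
      ((Real.continuous_mul_log.comp h2).div_const _)).neg
  · refine continuous_const.mul (Continuous.div_const (Continuous.log
      ((h1.rpow_const fun _ ↦ Or.inr hα.le).add (h2.rpow_const fun _ ↦ Or.inr hα.le)) ?_) _)
    intro x
    have hs1 : √(1 - x ^ 2) ≤ 1 := Real.sqrt_le_one.2 (by nlinarith)
    have : 0 ≤ ((1 - √(1 - x ^ 2)) / 2) ^ α := Real.rpow_nonneg (by linarith) _
    exact (add_pos_of_pos_of_nonneg (by positivity) this).ne'

/-- The slope decreases in `u`, and `u = arcosh (1 / x)` decreases in `x`, so the derivative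
increases in `x`. -/
theorem convexOn_concurrenceRenyi {α : ℝ} (hα : (√7 - 1) / 2 ≤ α) :
    ConvexOn ℝ (Set.Icc 0 1) (concurrenceRenyi α) := by
  have hα0 : 0 < α := by linarith [sqrt_seven_bounds.1]
  refine MonotoneOn.convexOn_of_deriv (convex_Icc 0 1)
    (continuous_concurrenceRenyi hα0).continuousOn ?_ ?_
  · rw [interior_Icc]
    exact fun x hx ↦
      (hasDerivAt_concurrenceRenyi α hx.1 hx.2).differentiableAt.differentiableWithinAt
  · rw [interior_Icc]
    intro x hx y hy hxy
    rw [(hasDerivAt_concurrenceRenyi α hx.1 hx.2).deriv,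
      (hasDerivAt_concurrenceRenyi α hy.1 hy.2).deriv]
    have hx' := (one_lt_inv₀ hx.1).2 hx.2
    have hy' := (one_lt_inv₀ hy.1).2 hy.2
    have := antitoneOn_hyperbolicSlope hα (Real.arcosh_pos hy') (Real.arcosh_pos hx')
      ((Real.arcosh_le_arcosh (by linarith) (by linarith)).2 (inv_anti₀ hx.1 hxy))
    exact div_le_div_of_nonneg_right this (Real.log_nonneg (by norm_num))

theorem concurrenceRenyi_zero {α : ℝ} (hα : α ≠ 0) : concurrenceRenyi α 0 = 0 := by
  unfold concurrenceRenyi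
  split_ifs <;> simp [Real.zero_rpow hα]

theorem concurrenceRenyi_nonneg {α x : ℝ} (hα : 0 < α) : 0 ≤ concurrenceRenyi α x := by
  have hs0 := Real.sqrt_nonneg (1 - x ^ 2)
  have hs1 : √(1 - x ^ 2) ≤ 1 := Real.sqrt_le_one.2 (by nlinarith)
  unfold concurrenceRenyi
  set l := (1 + √(1 - x ^ 2)) / 2 with hl
  set l' := (1 - √(1 - x ^ 2)) / 2 with hl'
  have hsum : l + l' = 1 := by rw [hl, hl']; ring
  have h0 : 0 < l := by positivity
  have h0' : 0 ≤ l' := by linarith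
  split_ifs with h
  · have a1 : Real.logb 2 l ≤ 0 := Real.logb_nonpos (by norm_num) h0.le (by linarith)
    have a2 : Real.logb 2 l' ≤ 0 := Real.logb_nonpos (by norm_num) h0' (by linarith)
    nlinarith
  · have hp : 0 < l ^ α + l' ^ α := by positivity
    rcases lt_or_gt_of_ne h with h | h
    · refine mul_nonneg (one_div_nonneg.2 (by linarith)) (Real.logb_nonneg (by norm_num) ?_)
      have b1 := Real.rpow_le_rpow_of_exponent_ge' h0.le (by linarith) hα.le h.le
      have b2 := Real.rpow_le_rpow_of_exponent_ge' h0' (by linarith) hα.le h.le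
      rw [Real.rpow_one] at b1 b2
      linarith
    · refine mul_nonneg_of_nonpos_of_nonpos (one_div_nonpos.2 (by linarith))
        (Real.logb_nonpos (by norm_num) hp.le ?_)
      have b1 := Real.rpow_le_rpow_of_exponent_ge' h0.le (by linarith) zero_le_one h.le
      have b2 := Real.rpow_le_rpow_of_exponent_ge' h0' (by linarith) zero_le_one h.le
      rw [Real.rpow_one] at b1 b2
      linarith

end Concurrence

/-! ### From convexity to squared and weighted monogamy inequalities. -/

section Monogamy

/-- A convex function on `[0, 1]` vanishing at `0` is superadditive, after squaring, in the
square of its argument. -/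
theorem sq_add_sq_le_of_convexOn {f : ℝ → ℝ} (hf : ConvexOn ℝ (Set.Icc 0 1) f) (h0 : f 0 = 0)
    (hn : ∀ x, 0 ≤ f x) {x y : ℝ} (hx : 0 ≤ x) (hy : 0 ≤ y) (hxy : x + y ≤ 1) :
    f √x ^ 2 + f √y ^ 2 ≤ f √(x + y) ^ 2 := by
  -- By convexity and `f 0 = 0`, `f √z` is at most `√z / √(x + y)` times `f √(x + y)`; adding the
  -- squared bounds at `z = x` and `z = y` finishes.
  have key {z : ℝ} (hz : 0 ≤ z) (hzs : z ≤ x + y) :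
      (x + y) * f √z ^ 2 ≤ z * f √(x + y) ^ 2 := by
    rcases (add_nonneg hx hy).eq_or_lt with h | h
    · have : z = 0 := by linarith
      simp [← h, this]
    have hs : 0 < √(x + y) := Real.sqrt_pos.2 h
    have hs1 : √(x + y) ≤ 1 := Real.sqrt_le_one.2 hxy
    have hr : √z ≤ √(x + y) := Real.sqrt_le_sqrt hzs
    have hr0 := Real.sqrt_nonneg z
    have := hf.2 (show (0 : ℝ) ∈ Set.Icc 0 1 by simp) (show √(x + y) ∈ Set.Icc 0 1 from ⟨hs.le, hs1⟩)
      (show 0 ≤ 1 - √z / √(x + y) from sub_nonneg.2 ((div_le_one hs).2 hr))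
      (show 0 ≤ √z / √(x + y) by positivity) (by ring)
    simp only [smul_eq_mul, mul_zero, h0, zero_add, div_mul_cancel₀ _ hs.ne'] at this
    have h2 := pow_le_pow_left₀ (hn _) this 2
    rw [mul_pow, div_pow, Real.sq_sqrt hz, Real.sq_sqrt h.le] at h2
    calc (x + y) * f √z ^ 2 ≤ (x + y) * (z / (x + y) * f √(x + y) ^ 2) := by gcongr
      _ = z * f √(x + y) ^ 2 := by field_simp
  rcases (add_nonneg hx hy).eq_or_lt with h | h
  · have hx0 : x = 0 := by linarith
    have hy0 : y = 0 := by linarith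
    simp [hx0, hy0, h0]
  have hx' := key hx (by linarith)
  have hy' := key hy (by linarith)
  refine le_of_mul_le_mul_left ?_ h
  linarith

theorem weight_nonneg {k β : ℝ} (hk0 : 0 < k) (hβ : 2 ≤ β) : 0 ≤ weight k β :=
  div_nonneg (sub_nonneg.2 (Real.one_le_rpow (by linarith) (by linarith))) (by positivity)

/-- The increments of a convex function are monotone. -/
theorem convexOn_add_le_add {f : ℝ → ℝ} (hf : ConvexOn ℝ (Set.Ici 0) f) {a b h : ℝ}
    (ha : 0 ≤ a) (hab : a ≤ b) (hh : 0 ≤ h) : f (a + h) + f b ≤ f (b + h) + f a := by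
  rcases (show 0 ≤ b - a + h by linarith).eq_or_lt with h0 | h0
  · have h1 : h = 0 := by linarith
    have h2 : b = a := by linarith
    simp [h1, h2]
  -- Both `a + h` and `b` are convex combinations of `a` and `b + h`, with the two weights
  -- interchanged.
  have hsum : (b - a) / (b - a + h) + h / (b - a + h) = 1 := by field_simp
  have p1 : 0 ≤ (b - a) / (b - a + h) := div_nonneg (by linarith) h0.le
  have p2 : 0 ≤ h / (b - a + h) := div_nonneg hh h0.le
  have e1 := hf.2 (show a ∈ Set.Ici 0 from ha)
    (show b + h ∈ Set.Ici 0 from by simp; linarith) p1 p2 hsum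
  have e2 := hf.2 (show a ∈ Set.Ici 0 from ha)
    (show b + h ∈ Set.Ici 0 from by simp; linarith) p2 p1 (by linarith)
  simp only [smul_eq_mul] at e1 e2
  have q1 : (b - a) / (b - a + h) * a + h / (b - a + h) * (b + h) = a + h := by
    field_simp; ring
  have q2 : h / (b - a + h) * a + (b - a) / (b - a + h) * (b + h) = b := by
    field_simp; ring
  rw [q1] at e1
  rw [q2] at e2
  have hs1 : (b - a) / (b - a + h) = 1 - h / (b - a + h) := by linarith
  rw [hs1] at e1 e2
  linarith

/-- Since `x / k ≤ 1`, convexity of `s ↦ s ^ (β / 2)` makes its increment over `[x / k, x / k + x]`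
at most that over `[1, 1 + x]`. As `x / k + x = (x / k) (1 + k)`, the former is exactly the weighted
term. -/
theorem one_add_weight_mul_le {k β x : ℝ} (hk0 : 0 < k) (hβ : 2 ≤ β) (hx0 : 0 ≤ x)
    (hxk : x ≤ k) : 1 + weight k β * x ^ (β / 2) ≤ (1 + x) ^ (β / 2) := by
  have hc0 : 0 ≤ x / k := by positivity
  have h := convexOn_add_le_add (convexOn_rpow (p := β / 2) (by linarith)) hc0
    ((div_le_one hk0).2 hxk) hx0
  have e1 : x / k + x = x / k * (1 + k) := by field_simp
  simp only [Real.one_rpow] at h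
  rw [e1, Real.mul_rpow hc0 (by linarith), Real.div_rpow hx0 hk0.le] at h
  have e2 : weight k β * x ^ (β / 2)
      = x ^ (β / 2) / k ^ (β / 2) * (1 + k) ^ (β / 2) - x ^ (β / 2) / k ^ (β / 2) := by
    unfold weight; ring
  linarith

theorem rpow_add_weight_mul_rpow_le {k β A B E : ℝ} (hk0 : 0 < k) (hβ : 2 ≤ β)
    (hA : 0 ≤ A) (hB : 0 ≤ B) (hE : 0 ≤ E) (h : A ^ 2 + B ^ 2 ≤ E ^ 2) (hBA : B ^ 2 ≤ k * A ^ 2) :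
    A ^ β + weight k β * B ^ β ≤ E ^ β := by
  have hsq {y : ℝ} (hy : 0 ≤ y) : y ^ β = (y ^ 2) ^ (β / 2) := by
    rw [← Real.rpow_natCast_mul hy]; congr 1; push_cast; ring
  rcases hA.eq_or_lt with h0 | h0
  · have : B = 0 := by
      rw [← h0] at hBA
      exact pow_eq_zero_iff (two_ne_zero) |>.1 (le_antisymm (by simpa using hBA) (sq_nonneg B))
    rw [this, ← h0, Real.zero_rpow (by linarith)]
    simpa using Real.rpow_nonneg hE β
  have hA2 : 0 < A ^ 2 := by positivity
  calc A ^ β + weight k β * B ^ β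
      = (A ^ 2) ^ (β / 2) * (1 + weight k β * (B ^ 2 / A ^ 2) ^ (β / 2)) := by
        rw [Real.div_rpow (sq_nonneg _) (sq_nonneg _), ← hsq hA, ← hsq hB]
        have : A ^ β ≠ 0 := (Real.rpow_pos_of_pos h0 β).ne'
        field_simp
    _ ≤ (A ^ 2) ^ (β / 2) * (1 + B ^ 2 / A ^ 2) ^ (β / 2) := by
        gcongr
        exact one_add_weight_mul_le hk0 hβ (by positivity) ((div_le_iff₀ hA2).2 hBA)
    _ = (A ^ 2 + B ^ 2) ^ (β / 2) := by
        rw [← Real.mul_rpow (sq_nonneg _) (by positivity)]; congr 1; field_simp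
    _ ≤ (E ^ 2) ^ (β / 2) := Real.rpow_le_rpow (by positivity) h (by linarith)
    _ = E ^ β := (hsq hE).symm

open Finset in
/-- Iterating the two one-step bounds over the tails `T m ≥ e m + K T (m + 1)` (`m ≤ t`) and
`T m ≥ K e m + T (m + 1)` (`t < m`). -/
theorem weighted_sum_le {e T : ℕ → ℝ} {K : ℝ} (hK : 0 ≤ K) {t l : ℕ} (htl : t + 1 ≤ l)
    (hlast : e l ≤ T l)
    (hlow : ∀ m ≤ t, e m + K * T (m + 1) ≤ T m)
    (hhigh : ∀ m, t + 1 ≤ m → m < l → K * e m + T (m + 1) ≤ T m) :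
    ∑ m ∈ range (t + 1), K ^ m * e m + K ^ (t + 2) * ∑ m ∈ Ico (t + 1) l, e m
      + K ^ (t + 1) * e l ≤ T 0 := by
  have h1 : ∀ m, t + 1 ≤ m → m ≤ l → K * ∑ i ∈ Ico (t + 1) m, e i + T m ≤ T (t + 1) := by
    intro m hm
    induction m, hm using Nat.le_induction with
    | base => simp
    | succ m hm ih =>
      intro hl
      rw [sum_Ico_succ_top hm]
      linarith [ih (by omega), hhigh m hm (by omega)]
  have h2 : ∀ m ≤ t + 1, ∑ i ∈ range m, K ^ i * e i + K ^ m * T m ≤ T 0 := by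
    intro m
    induction m with
    | zero => simp
    | succ m ih =>
      intro hm
      rw [sum_range_succ, pow_succ]
      have := mul_le_mul_of_nonneg_left (hlow m (by omega)) (pow_nonneg hK m)
      linarith [ih (by omega)]
  have h3 := mul_le_mul_of_nonneg_left (h1 l htl le_rfl) (pow_nonneg hK (t + 1))
  have h4 := mul_le_mul_of_nonneg_left hlast (pow_nonneg hK (t + 1))
  have h5 := h2 (t + 1) le_rfl
  have : K ^ (t + 2) = K ^ (t + 1) * K := pow_succ _ _
  rw [this]
  linarith

end Monogamy

/-! ### Entanglement of pure states with no joint excitation. -/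

section PureStates

variable {A B : Type} [Fintype A] [DecidableEq A] [Fintype B]

theorem trace_mul_self_eq_sum_eigenvalues_sq {ρ : Matrix A A ℂ} (hρ : ρ.IsHermitian) :
    (ρ * ρ).trace = ∑ i, ((hρ.eigenvalues i ^ 2 : ℝ) : ℂ) := by
  have h := congrArg Matrix.trace
    (congrArg₂ (· * ·) hρ.spectral_theorem hρ.spectral_theorem)
  simp only [← map_mul] at h
  rw [h, Unitary.conjStarAlgAut_apply, Matrix.trace_mul_comm, ← mul_assoc]
  simp [Matrix.diagonal_mul_diagonal, Matrix.trace_diagonal, sq]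

/-- The spectrum of a density matrix of rank at most two is determined by its purity. -/
theorem sum_eigenvalues_of_rank_le_two {ρ : Matrix A A ℂ} (hρ : ρ.IsHermitian) (hr : ρ.rank ≤ 2)
    (h1 : ρ.trace = 1) {C : ℝ} (h2 : (ρ * ρ).trace = ((1 - C ^ 2 / 2 : ℝ) : ℂ))
    {g : ℝ → ℝ} (hg : g 0 = 0) :
    ∑ i, g (hρ.eigenvalues i) = g ((1 + √(1 - C ^ 2)) / 2) + g ((1 - √(1 - C ^ 2)) / 2) := by
  have hsum : ∑ i, hρ.eigenvalues i = 1 := by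
    have := hρ.trace_eq_sum_eigenvalues
    rw [h1] at this
    simpa using (congrArg Complex.re this).symm
  have hsq : ∑ i, hρ.eigenvalues i ^ 2 = 1 - C ^ 2 / 2 := by
    have := trace_mul_self_eq_sum_eigenvalues_sq hρ
    rw [h2] at this
    exact_mod_cast this.symm
  rw [hρ.rank_eq_card_non_zero_eigs, Fintype.card_subtype] at hr
  have hs (f : ℝ → ℝ) (hf : f 0 = 0) : ∑ i, f (hρ.eigenvalues i)
      = ∑ i with hρ.eigenvalues i ≠ 0, f (hρ.eigenvalues i) := by
    refine (Finset.sum_filter_of_ne (p := fun i ↦ hρ.eigenvalues i ≠ 0) fun i _ hi h0 ↦ hi ?_).symm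
    rw [h0, hf]
  rw [hs (fun x ↦ x) rfl] at hsum
  rw [hs (· ^ 2) (by simp)] at hsq
  rw [hs g hg]
  generalize Finset.univ.filter (fun i ↦ hρ.eigenvalues i ≠ 0) = s at *
  have hcard : s.card = 0 ∨ s.card = 1 ∨ s.card = 2 := by omega
  rcases hcard with h | h | h
  · rw [Finset.card_eq_zero] at h
    simp [h] at hsum
  · obtain ⟨i, rfl⟩ := Finset.card_eq_one.1 h
    simp only [Finset.sum_singleton] at hsum hsq ⊢
    rw [hsum] at hsq ⊢
    have hC : C ^ 2 = 0 := by linarith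
    simp [hC, hg]
  · obtain ⟨i, j, hij, rfl⟩ := Finset.card_eq_two.1 h
    rw [Finset.sum_pair hij] at hsum hsq ⊢
    generalize hρ.eigenvalues i = x at *
    generalize hρ.eigenvalues j = y at *
    -- From `x + y = 1` and `x² + y² = 1 - C² / 2`.
    have hxy : 1 - C ^ 2 = (x - y) ^ 2 := by
      have : y = 1 - x := by linarith
      subst this
      linear_combination (-2) * hsq
    rw [hxy, Real.sqrt_sq_eq_abs]
    rcases abs_cases (x - y) with ⟨h, -⟩ | ⟨h, -⟩ <;> rw [h]
    · rw [show (1 + (x - y)) / 2 = x by linarith, show (1 - (x - y)) / 2 = y by linarith]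
    · rw [show (1 + -(x - y)) / 2 = y by linarith, show (1 - -(x - y)) / 2 = x by linarith,
        add_comm]

theorem rank_vecMulVec_add_le_two {A : Type} [Fintype A] (u v w z : A → ℂ) :
    (Matrix.vecMulVec u v + Matrix.vecMulVec w z).rank ≤ 2 := by
  have : Matrix.vecMulVec u v + Matrix.vecMulVec w z
      = Matrix.of (fun a (i : Fin 2) ↦ ![u a, w a] i) * Matrix.of (fun (i : Fin 2) a ↦ ![v, z] i a) := by
    ext a b
    simp [Matrix.mul_apply, Matrix.vecMulVec_apply]
  rw [this]
  exact (Matrix.rank_mul_le_left _ _).trans ((Matrix.rank_le_card_width _).trans_eq (Fintype.card_fin 2))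

theorem renyiEntropy_of_rank_le_two {α : ℝ} (hα : α ≠ 0) {ρ : Matrix A A ℂ}
    (hρ : ρ.IsHermitian) (hr : ρ.rank ≤ 2)
    (h1 : ρ.trace = 1) {C : ℝ} (h2 : (ρ * ρ).trace = ((1 - C ^ 2 / 2 : ℝ) : ℂ)) :
    renyiEntropy α hρ = concurrenceRenyi α C := by
  unfold renyiEntropy concurrenceRenyi
  split_ifs
  · rw [sum_eigenvalues_of_rank_le_two hρ hr h1 h2 (g := fun x ↦ x * Real.logb 2 x) (by simp)]
  · rw [sum_eigenvalues_of_rank_le_two hρ hr h1 h2 (g := fun x ↦ x ^ α)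
      (Real.zero_rpow hα)]

/-- The marginal of a vector supported on `A × {b₀} ∪ {a₀} × B`. -/
theorem marginal_eq_of_support {A B : Type} [DecidableEq A] [Fintype B] [DecidableEq B] {a₀ : A} {b₀ : B} {φ : A × B → ℂ}
    (hφ : ∀ a b, a ≠ a₀ → b ≠ b₀ → φ (a, b) = 0) :
    marginal φ = Matrix.vecMulVec (fun a ↦ φ (a, b₀)) (star fun a ↦ φ (a, b₀))
      + Matrix.vecMulVec (Pi.single a₀ ((∑ b with b ≠ b₀, ‖φ (a₀, b)‖ ^ 2 : ℝ) : ℂ))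
          (Pi.single a₀ 1) := by
  ext a a'
  simp only [marginal, Matrix.of_apply, Matrix.add_apply, Matrix.vecMulVec_apply, Pi.star_apply]
  rw [← Finset.add_sum_erase _ _ (Finset.mem_univ b₀), ← Finset.filter_ne']
  congr 1
  by_cases ha : a = a₀
  · by_cases ha' : a' = a₀
    · subst ha ha'
      simp [Complex.mul_conj, Complex.normSq_eq_norm_sq]
    · rw [Pi.single_eq_of_ne ha', mul_zero]
      refine Finset.sum_eq_zero fun b hb ↦ ?_
      rw [hφ a' b ha' (Finset.mem_filter.1 hb).2, star_zero, mul_zero]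
  · rw [Pi.single_eq_of_ne ha, zero_mul]
    refine Finset.sum_eq_zero fun b hb ↦ ?_
    rw [hφ a b ha (Finset.mem_filter.1 hb).2, zero_mul]

theorem sum_norm_sq_of_support [DecidableEq B] {a₀ : A} {b₀ : B} {φ : A × B → ℂ}
    (hφ : ∀ a b, a ≠ a₀ → b ≠ b₀ → φ (a, b) = 0) :
    ∑ x, ‖φ x‖ ^ 2 = ‖φ (a₀, b₀)‖ ^ 2 + ∑ a with a ≠ a₀, ‖φ (a, b₀)‖ ^ 2
      + ∑ b with b ≠ b₀, ‖φ (a₀, b)‖ ^ 2 := by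
  rw [Fintype.sum_prod_type, ← Finset.add_sum_erase _ _ (Finset.mem_univ a₀),
    ← Finset.add_sum_erase _ _ (Finset.mem_univ b₀), ← Finset.filter_ne', ← Finset.filter_ne']
  have : ∑ a with a ≠ a₀, ∑ b, ‖φ (a, b)‖ ^ 2 = ∑ a with a ≠ a₀, ‖φ (a, b₀)‖ ^ 2 := by
    refine Finset.sum_congr rfl fun a ha ↦ ?_
    refine Fintype.sum_eq_single b₀ fun b hb ↦ ?_
    rw [hφ a b (Finset.mem_filter.1 ha).2 hb]
    simp
  rw [this]
  ring

/-- The marginal is `|u⟩⟨u| + Y |a₀⟩⟨a₀|` with `‖u‖² = 1 - Y` and `|u a₀|² = 1 - X - Y`. Its purity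
is `(1 - Y)² + 2 Y (1 - X - Y) + Y² = 1 - 2 X Y`, which corresponds to `C² = 4 X Y`. -/
theorem pureEntanglement_of_support [DecidableEq B] {α : ℝ} (hα : α ≠ 0) {a₀ : A} {b₀ : B}
    {φ : A × B → ℂ} (hφ : ∀ a b, a ≠ a₀ → b ≠ b₀ → φ (a, b) = 0) (hnorm : ∑ x, ‖φ x‖ ^ 2 = 1) :
    pureEntanglement α φ = concurrenceRenyi α (2 * √((∑ a with a ≠ a₀, ‖φ (a, b₀)‖ ^ 2)
      * ∑ b with b ≠ b₀, ‖φ (a₀, b)‖ ^ 2)) := by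
  have hm := marginal_eq_of_support hφ
  rw [sum_norm_sq_of_support hφ] at hnorm
  set X := ∑ a with a ≠ a₀, ‖φ (a, b₀)‖ ^ 2 with hX
  set Y := ∑ b with b ≠ b₀, ‖φ (a₀, b)‖ ^ 2 with hY
  set u : A → ℂ := fun a ↦ φ (a, b₀) with hu
  have hX0 : 0 ≤ X := Finset.sum_nonneg fun _ _ ↦ sq_nonneg _
  have hY0 : 0 ≤ Y := Finset.sum_nonneg fun _ _ ↦ sq_nonneg _
  have huu : u ⬝ᵥ star u = ((‖φ (a₀, b₀)‖ ^ 2 + X : ℝ) : ℂ) := by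
    rw [dotProduct, ← Finset.add_sum_erase _ _ (Finset.mem_univ a₀), ← Finset.filter_ne', hX, hu]
    push_cast
    simp [Complex.mul_conj, Complex.normSq_eq_norm_sq]
  have h0 : φ (a₀, b₀) * star (φ (a₀, b₀)) = ((‖φ (a₀, b₀)‖ ^ 2 : ℝ) : ℂ) := by
    simp [Complex.mul_conj, Complex.normSq_eq_norm_sq]
  refine renyiEntropy_of_rank_le_two hα _ ?_ ?_ ?_
  · rw [hm]
    exact rank_vecMulVec_add_le_two _ _ _ _
  · rw [hm, Matrix.trace_add, Matrix.trace_vecMulVec, Matrix.trace_vecMulVec, huu]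
    simp only [single_dotProduct, Pi.single_eq_same, mul_one]
    exact_mod_cast hnorm
  · rw [hm]
    simp only [mul_add, add_mul, Matrix.vecMulVec_mul_vecMulVec, Matrix.trace_add,
      Matrix.trace_vecMulVec]
    have hu0 : u a₀ * star (u a₀) = ((‖φ (a₀, b₀)‖ ^ 2 : ℝ) : ℂ) := h0
    have hXY : (((2 * √(X * Y)) ^ 2 : ℝ) : ℂ) = 4 * X * Y := by
      rw [mul_pow, Real.sq_sqrt (mul_nonneg hX0 hY0)]
      push_cast
      ring
    have hz : ((‖φ (a₀, b₀)‖ ^ 2 : ℝ) : ℂ) = 1 - X - Y := by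
      rw [show ‖φ (a₀, b₀)‖ ^ 2 = 1 - X - Y by linarith]
      push_cast
      rfl
    rw [Complex.ofReal_sub, Complex.ofReal_div, hXY]
    rw [Complex.ofReal_add, hz] at huu
    rw [hz] at hu0
    simp only [dotProduct_smul, dotProduct_comm (star u) u, huu, single_dotProduct,
      dotProduct_single, Pi.star_apply, Pi.single_eq_same, smul_eq_mul, one_mul, mul_one,
      Complex.ofReal_one, Complex.ofReal_ofNat]
    linear_combination (2 * Y : ℂ) * hu0

end PureStates

/-! ### The convex roof for a pure state mixed with the vacuum. -/

section MixedStates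

variable {A B : Type} [Fintype A] [DecidableEq A] [Fintype B]

/-- The mixture of `|v⟩⟨v|` with weight `c` on the basis vector `o`. -/
def addVacuum {X : Type} [DecidableEq X] (v : X → ℂ) (o : X) (c : ℝ) : Matrix X X ℂ :=
  Matrix.of fun x y ↦ v x * star (v y) + if x = o ∧ y = o then (c : ℂ) else 0

/-- The off-vacuum parts of all vectors in a pure decomposition of `|v⟩⟨v| + c |o⟩⟨o|` are
multiples of the off-vacuum part of `v`, with mean square factor one. -/
theorem exists_coeff_of_decomposition [DecidableEq B] {v : A × B → ℂ} {o : A × B} {c : ℝ} {m : ℕ}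
    {q : Fin m → ℝ} {φ : Fin m → A × B → ℂ}
    (h : IsPureDecomposition (addVacuum v o c) q φ) :
    ∃ x : Fin m → ℂ, ∑ k, q k * ‖x k‖ ^ 2 = 1 ∧
      ∀ k, q k ≠ 0 → ∀ b, b ≠ o → φ k b = x k * v b := by
  obtain ⟨hq, hq1, -, hρ⟩ := h
  have hent {b b' : A × B} (hb : b ≠ o) :
      ∑ k, (q k : ℂ) * (φ k b * star (φ k b')) = v b * star (v b') := by
    have := congrFun (congrFun hρ b) b'
    rw [addVacuum, Matrix.of_apply, if_neg (fun h ↦ hb h.1), add_zero, Matrix.sum_apply] at this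
    rw [this]
    simp [Matrix.vecMulVec_apply]
  have hzero {f : Fin m → ℂ} (hf : ∑ k, (q k : ℂ) * (f k * star (f k)) = 0) {k : Fin m}
      (hk : q k ≠ 0) : f k = 0 := by
    have hr : ∑ k, q k * ‖f k‖ ^ 2 = 0 := by
      have e : ∀ k, (q k : ℂ) * (f k * star (f k)) = ((q k * ‖f k‖ ^ 2 : ℝ) : ℂ) := by
        intro k
        simp [Complex.mul_conj, Complex.normSq_eq_norm_sq]
      simp only [e] at hf
      exact_mod_cast hf
    have := (Finset.sum_eq_zero_iff_of_nonneg fun k _ ↦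
      mul_nonneg (hq k) (sq_nonneg ‖f k‖)).1 hr k (Finset.mem_univ k)
    simpa [hk] using this
  -- The `q`-average of the squared modulus of this minor is fixed by off-vacuum entries of the
  -- density matrix, where it equals the value for `v` itself, namely zero.
  have hprop {b b' : A × B} (hb : b ≠ o) (hb' : b' ≠ o) {k : Fin m} (hk : q k ≠ 0) :
      φ k b * v b' - φ k b' * v b = 0 := by
    refine hzero (f := fun k ↦ φ k b * v b' - φ k b' * v b) ?_ hk
    have e : ∀ k, (q k : ℂ) * ((φ k b * v b' - φ k b' * v b) * star (φ k b * v b' - φ k b' * v b))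
        = (q k : ℂ) * (φ k b * star (φ k b)) * (v b' * star (v b'))
          - (q k : ℂ) * (φ k b * star (φ k b')) * (v b' * star (v b))
          - (q k : ℂ) * (φ k b' * star (φ k b)) * (v b * star (v b'))
          + (q k : ℂ) * (φ k b' * star (φ k b')) * (v b * star (v b)) := by
      intro k
      simp only [star_sub, star_mul']
      ring
    simp only [e, Finset.sum_add_distrib, Finset.sum_sub_distrib, ← Finset.sum_mul]
    rw [hent hb, hent hb, hent hb', hent hb']
    ring
  by_cases hv : ∃ b, b ≠ o ∧ v b ≠ 0
  · obtain ⟨b, hb, hvb⟩ := hv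
    refine ⟨fun k ↦ φ k b / v b, ?_, fun k hk b' hb' ↦ ?_⟩
    · have hbb := hent (b' := b) hb
      have e : ∀ k, (q k : ℂ) * (φ k b * star (φ k b)) = ((q k * ‖φ k b‖ ^ 2 : ℝ) : ℂ) := by
        intro k
        simp [Complex.mul_conj, Complex.normSq_eq_norm_sq]
      simp only [e] at hbb
      rw [show v b * star (v b) = ((‖v b‖ ^ 2 : ℝ) : ℂ) by
        simp [Complex.mul_conj, Complex.normSq_eq_norm_sq]] at hbb
      have hr : ∑ k, q k * ‖φ k b‖ ^ 2 = ‖v b‖ ^ 2 := by exact_mod_cast hbb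
      have hn : ‖v b‖ ^ 2 ≠ 0 := by simpa using hvb
      simp only [norm_div, div_pow, ← mul_div_assoc]
      rw [← Finset.sum_div, hr, div_self hn]
    · have := hprop hb hb' hk
      field_simp
      linear_combination -this
  · push Not at hv
    refine ⟨fun _ ↦ 1, by simpa using hq1, fun k hk b hb ↦ ?_⟩
    rw [hv b hb, mul_zero]
    refine hzero (f := fun k ↦ φ k b) ?_ hk
    rw [hent hb, hv b hb, zero_mul]

/-- Two equiprobable pure states of `|v⟩⟨v| + c |o⟩⟨o|`. -/
theorem isPureDecomposition_addVacuum [DecidableEq B] {v : A × B → ℂ} {o : A × B} {c : ℝ}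
    (hc : 0 ≤ c) (hv : (v o).im = 0) (hnorm : ∑ x, ‖v x‖ ^ 2 + c = 1) :
    IsPureDecomposition (addVacuum v o c) (fun _ : Fin 2 ↦ 1 / 2)
      ![v + Pi.single o (√c * Complex.I), v - Pi.single o (√c * Complex.I)] := by
  have hcc : (√c : ℂ) * √c = c := by exact_mod_cast Real.mul_self_sqrt hc
  -- Because `v o` is real, the imaginary shift raises the squared norm by exactly `c`; the opposite
  -- signs cancel the cross terms in the mixture.
  have hnorm2 (s : ℝ) (hs : s ^ 2 = 1) :
      ∑ x, ‖(v + Pi.single o (s * √c * Complex.I) : A × B → ℂ) x‖ ^ 2 = 1 := by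
    rw [← hnorm, ← Finset.add_sum_erase _ _ (Finset.mem_univ o),
      ← Finset.add_sum_erase _ (fun x ↦ ‖v x‖ ^ 2) (Finset.mem_univ o)]
    have h1 : ∑ x ∈ Finset.univ.erase o, ‖(v + Pi.single o (s * √c * Complex.I) : A × B → ℂ) x‖ ^ 2
        = ∑ x ∈ Finset.univ.erase o, ‖v x‖ ^ 2 := by
      refine Finset.sum_congr rfl fun x hx ↦ ?_
      simp [Pi.single_eq_of_ne (Finset.ne_of_mem_erase hx)]
    have h2 : ‖(v + Pi.single o (s * √c * Complex.I) : A × B → ℂ) o‖ ^ 2 = ‖v o‖ ^ 2 + c := by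
      simp only [← Complex.normSq_eq_norm_sq, Complex.normSq_apply, Pi.add_apply,
        Pi.single_eq_same, Complex.add_re, Complex.add_im, hv]
      simp
      nlinarith [Real.mul_self_sqrt hc]
    rw [h1, h2]
    ring
  refine ⟨fun _ ↦ by norm_num, by simp, fun k ↦ ?_, ?_⟩
  · fin_cases k
    · simpa using hnorm2 1 (by norm_num)
    · have := hnorm2 (-1) (by norm_num)
      rw [← this]
      refine Finset.sum_congr rfl fun x _ ↦ ?_
      simp only [Fin.mk_one, Matrix.cons_val_one, Matrix.cons_val_fin_one, sub_eq_add_neg,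
        ← Pi.single_neg]
      congr 4
      push_cast
      ring_nf
  · ext x y
    simp only [Fin.sum_univ_two, Matrix.cons_val_zero, Matrix.cons_val_one, Matrix.cons_val_fin_one,
      addVacuum, Matrix.of_apply, Matrix.add_apply, Matrix.smul_apply, Matrix.vecMulVec_apply,
      Pi.add_apply, Pi.sub_apply, Pi.star_apply, star_add, star_sub, smul_eq_mul]
    by_cases hx : x = o <;> by_cases hy : y = o
    · subst hx hy
      simp
      linear_combination (-1) * hcc + √c * √c * Complex.I_sq
    all_goals simp [hx, hy]; ring

/-- The Rényi entanglement of `|v⟩⟨v| + c |a₀b₀⟩⟨a₀b₀|`, where `v` is supported on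
`A × {b₀} ∪ {a₀} × B`. -/
theorem renyiEntanglement_addVacuum [DecidableEq B] {α : ℝ} (hα : (√7 - 1) / 2 ≤ α)
    {a₀ : A} {b₀ : B} {v : A × B → ℂ} (hsupp : ∀ a b, a ≠ a₀ → b ≠ b₀ → v (a, b) = 0)
    {c : ℝ} (hc : 0 ≤ c) (hv : (v (a₀, b₀)).im = 0) (hnorm : ∑ x, ‖v x‖ ^ 2 + c = 1) :
    renyiEntanglement α (addVacuum v (a₀, b₀) c)
      = concurrenceRenyi α (2 * √((∑ a with a ≠ a₀, ‖v (a, b₀)‖ ^ 2)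
        * ∑ b with b ≠ b₀, ‖v (a₀, b)‖ ^ 2)) := by
  have hα0 : 0 < α := by linarith [sqrt_seven_bounds.1]
  -- a unit vector whose off-vacuum part is `x v` has concurrence `‖x‖² C`
  have hpure {φ : A × B → ℂ} {x : ℂ} (hφ1 : ∑ z, ‖φ z‖ ^ 2 = 1)
      (hφ : ∀ z, z ≠ (a₀, b₀) → φ z = x * v z) :
      ‖x‖ ^ 2 * (2 * √((∑ a with a ≠ a₀, ‖v (a, b₀)‖ ^ 2) * ∑ b with b ≠ b₀, ‖v (a₀, b)‖ ^ 2))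
          ∈ Set.Icc (0 : ℝ) 1 ∧
      pureEntanglement α φ = concurrenceRenyi α (‖x‖ ^ 2 *
        (2 * √((∑ a with a ≠ a₀, ‖v (a, b₀)‖ ^ 2) * ∑ b with b ≠ b₀, ‖v (a₀, b)‖ ^ 2))) := by
    have hs : ∀ a b, a ≠ a₀ → b ≠ b₀ → φ (a, b) = 0 := by
      intro a b ha hb
      rw [hφ _ (by simp [ha]), hsupp a b ha hb, mul_zero]
    have e1 : ∑ a with a ≠ a₀, ‖φ (a, b₀)‖ ^ 2 = ‖x‖ ^ 2 * ∑ a with a ≠ a₀, ‖v (a, b₀)‖ ^ 2 := by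
      rw [Finset.mul_sum]
      refine Finset.sum_congr rfl fun a ha ↦ ?_
      rw [hφ _ (by simpa using ha), norm_mul, mul_pow]
    have e2 : ∑ b with b ≠ b₀, ‖φ (a₀, b)‖ ^ 2 = ‖x‖ ^ 2 * ∑ b with b ≠ b₀, ‖v (a₀, b)‖ ^ 2 := by
      rw [Finset.mul_sum]
      refine Finset.sum_congr rfl fun b hb ↦ ?_
      rw [hφ _ (by simpa using hb), norm_mul, mul_pow]
    have hp := pureEntanglement_of_support hα0.ne' hs hφ1
    rw [sum_norm_sq_of_support hs] at hφ1
    have hP : 0 ≤ ∑ a with a ≠ a₀, ‖φ (a, b₀)‖ ^ 2 := Finset.sum_nonneg fun _ _ ↦ sq_nonneg _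
    have hQ : 0 ≤ ∑ b with b ≠ b₀, ‖φ (a₀, b)‖ ^ 2 := Finset.sum_nonneg fun _ _ ↦ sq_nonneg _
    rw [e1] at hP
    rw [e2] at hQ
    rw [e1, e2] at hp hφ1
    generalize (∑ a with a ≠ a₀, ‖v (a, b₀)‖ ^ 2) = X at *
    generalize (∑ b with b ≠ b₀, ‖v (a₀, b)‖ ^ 2) = Y at *
    have e3 : 2 * √(‖x‖ ^ 2 * X * (‖x‖ ^ 2 * Y)) = ‖x‖ ^ 2 * (2 * √(X * Y)) := by
      rw [show ‖x‖ ^ 2 * X * (‖x‖ ^ 2 * Y) = (‖x‖ ^ 2) ^ 2 * (X * Y) by ring,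
        Real.sqrt_mul (sq_nonneg _), Real.sqrt_sq (sq_nonneg _)]
      ring
    rw [e3] at hp
    refine ⟨⟨by positivity, ?_⟩, hp⟩
    rw [← e3]
    -- The arithmetic-geometric mean inequality for two weights with sum at most one.
    have : √(‖x‖ ^ 2 * X * (‖x‖ ^ 2 * Y)) ≤ 1 / 2 := by
      refine Real.sqrt_le_iff.2 ⟨by norm_num, ?_⟩
      have hle : ‖x‖ ^ 2 * X + ‖x‖ ^ 2 * Y ≤ 1 := by linarith [sq_nonneg ‖φ (a₀, b₀)‖]
      have := pow_le_one₀ (n := 2) (add_nonneg hP hQ) hle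
      nlinarith [sq_nonneg (‖x‖ ^ 2 * X - ‖x‖ ^ 2 * Y)]
    linarith
  set C := 2 * √((∑ a with a ≠ a₀, ‖v (a, b₀)‖ ^ 2) * ∑ b with b ≠ b₀, ‖v (a₀, b)‖ ^ 2) with hC
  have hleast : IsLeast {e : ℝ | ∃ (m : ℕ) (q : Fin m → ℝ) (φ : Fin m → A × B → ℂ),
      IsPureDecomposition (addVacuum v (a₀, b₀) c) q φ ∧ e = ∑ k, q k * pureEntanglement α (φ k)}
      (concurrenceRenyi α C) := by
    constructor
    · have hd := isPureDecomposition_addVacuum hc hv hnorm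
      refine ⟨2, _, _, hd, ?_⟩
      have h0 := (hpure (x := 1) (hd.2.2.1 0) (by intro z hz; simp [Pi.single_eq_of_ne hz])).2
      have h1 := (hpure (x := 1) (hd.2.2.1 1) (by intro z hz; simp [Pi.single_eq_of_ne hz])).2
      rw [Fin.sum_univ_two, h0, h1]
      simp
      ring
    · rintro _ ⟨m, q, φ, hd, rfl⟩
      obtain ⟨x, hx1, hx⟩ := exists_coeff_of_decomposition hd
      obtain ⟨hq, hq1, hφ1, -⟩ := hd
      -- Terms of zero probability carry no information about `x k`; the value `0` keeps them in
      -- `[0, 1]`, as Jensen requires.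
      let y : Fin m → ℝ := fun k ↦ if q k = 0 then 0 else ‖x k‖ ^ 2 * C
      have hy (k : Fin m) : y k ∈ Set.Icc (0 : ℝ) 1 ∧
          q k * pureEntanglement α (φ k) = q k * concurrenceRenyi α (y k) := by
        by_cases hk : q k = 0
        · simp [y, hk]
        · have := hpure (hφ1 k) (hx k hk)
          simpa only [y, if_neg hk, this.2, and_true] using this.1
      have hmean : ∑ k, q k * y k = C := by
        calc ∑ k, q k * y k = ∑ k, q k * ‖x k‖ ^ 2 * C := by
              refine Finset.sum_congr rfl fun k _ ↦ ?_
              by_cases hk : q k = 0 <;> simp [y, hk, mul_assoc]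
          _ = C := by rw [← Finset.sum_mul, hx1, one_mul]
      have := (convexOn_concurrenceRenyi hα).map_sum_le (t := Finset.univ) (p := y)
        (fun k _ ↦ hq k) hq1 fun k _ ↦ (hy k).1
      simp only [smul_eq_mul, hmean] at this
      rwa [Finset.sum_congr rfl fun k _ ↦ (hy k).2]
  exact hleast.csInf_eq

end MixedStates

/-! ### Reduced states of single-excitation superpositions. -/

section ReducedStates

variable {n d : ℕ} [NeZero d]

/-- The state is a superposition of basis states with at most one excited site. -/
def AtMostOneExcitation (ψ : (Fin n → Fin d) → ℂ) : Prop :=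
  ∀ x s s', s ≠ s' → x s ≠ 0 → x s' ≠ 0 → ψ x = 0

/-- The probability of finding an excitation among the sites in `S`. -/
def excitationWeight (ψ : (Fin n → Fin d) → ℂ) (S : Finset (Fin n)) : ℝ :=
  ∑ s ∈ S, ∑ i with i ≠ 0, ‖ψ (Pi.single s i)‖ ^ 2

theorem excitationWeight_nonneg (ψ : (Fin n → Fin d) → ℂ) (S : Finset (Fin n)) :
    0 ≤ excitationWeight ψ S :=
  Finset.sum_nonneg fun _ _ ↦ Finset.sum_nonneg fun _ _ ↦ sq_nonneg _

theorem excitationWeight_union (ψ : (Fin n → Fin d) → ℂ) {S T : Finset (Fin n)}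
    (h : Disjoint S T) :
    excitationWeight ψ (S ∪ T) = excitationWeight ψ S + excitationWeight ψ T :=
  Finset.sum_union h

/-- Extension by `0` of a configuration of the sites satisfying `p`. -/
def extendZero (p : Fin n → Prop) [DecidablePred p] (y : {s // p s} → Fin d) : Fin n → Fin d :=
  fun s ↦ if h : p s then y ⟨s, h⟩ else 0

/-- Only configurations with exactly one excited site contribute to the left side, and these are
indexed by a site and a nonzero level. -/
theorem sum_extendZero {ψ : (Fin n → Fin d) → ℂ} (hψ : AtMostOneExcitation ψ)
    (p : Fin n → Prop) [DecidablePred p] [Fintype {s // p s}] :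
    ∑ y : {s // p s} → Fin d with y ≠ 0, ‖ψ (extendZero p y)‖ ^ 2
      = excitationWeight ψ (Finset.univ.filter p) := by
  have hsingle {s : Fin n} (hs : p s) (i : Fin d) :
      extendZero p (fun t ↦ (Pi.single s i : Fin n → Fin d) t) = Pi.single s i := by
    ext t
    by_cases ht : p t
    · simp [extendZero, ht]
    · have : t ≠ s := fun h ↦ ht (h ▸ hs)
      simp [extendZero, ht, Pi.single_eq_of_ne this]
  unfold excitationWeight
  rw [← Finset.sum_product']
  symm
  refine Finset.sum_of_injOn (fun z t ↦ (Pi.single z.1 z.2 : Fin n → Fin d) t) ?_ ?_ ?_ ?_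
  · rintro ⟨s, i⟩ hz ⟨s', i'⟩ hz' h
    simp only [Finset.coe_product, Set.mem_prod, Finset.coe_filter, Finset.mem_univ, true_and,
      Set.mem_ofPred_eq] at hz hz' h
    have hs := congrFun h ⟨s, hz.1⟩
    simp only [Pi.single_eq_same] at hs
    by_cases hss : s = s'
    · subst hss
      simpa using hs
    · rw [Pi.single_eq_of_ne hss] at hs
      exact absurd hs hz.2
  · rintro ⟨s, i⟩ hz
    simp only [Finset.coe_product, Set.mem_prod, Finset.coe_filter, Finset.mem_univ, true_and,
      Set.mem_ofPred_eq] at hz ⊢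
    intro h
    have := congrFun h ⟨s, hz.1⟩
    simp only [Pi.single_eq_same] at this
    exact hz.2 this
  · intro y hy hny
    obtain ⟨s, hs⟩ := Function.ne_iff.1 (Finset.mem_filter.1 hy).2
    by_cases hall : ∀ t, t ≠ s → y t = 0
    · refine absurd ⟨(s.1, y s), ?_, ?_⟩ hny
      · exact Finset.mem_coe.2 (Finset.mem_product.2 (by simpa using ⟨s.2, hs⟩))
      · ext t
        by_cases ht : t = s
        · subst ht; simp
        · rw [hall t ht]
          simp only
          rw [Pi.single_eq_of_ne (fun h ↦ ht (Subtype.ext h))]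
    · push Not at hall
      obtain ⟨t, hts, ht⟩ := hall
      rw [hψ _ t.1 s.1 (fun h ↦ hts (Subtype.ext h)) (by simpa [extendZero, t.2] using ht)
        (by simpa [extendZero, s.2] using hs)]
      simp
  · rintro ⟨s, i⟩ hz
    simp only [Finset.mem_product, Finset.mem_filter, Finset.mem_univ, true_and] at hz
    simp only
    rw [hsingle hz.1]

theorem glue_zero_right (S T : Finset (Fin n)) (x : Config d S) :
    glue S T x 0 0 = extendZero (· ∈ S) x := by
  ext s
  by_cases hS : s ∈ S <;> by_cases hT : s ∈ T <;> simp [glue, extendZero, hS, hT]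

theorem glue_zero_outer {S T : Finset (Fin n)} (h : Disjoint S T) (y : Config d T) :
    glue S T 0 y 0 = extendZero (· ∈ T) y := by
  ext s
  by_cases hS : s ∈ S
  · simp [glue, extendZero, hS, Finset.disjoint_left.1 h hS]
  · by_cases hT : s ∈ T <;> simp [glue, extendZero, hS, hT]

theorem glue_zero_left (S T : Finset (Fin n)) (z : {s // s ∉ S ∪ T} → Fin d) :
    glue S T 0 0 z = extendZero (· ∉ S ∪ T) z := by
  ext s
  by_cases hS : s ∈ S <;> by_cases hT : s ∈ T <;> simp [glue, extendZero, hS, hT]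

theorem glue_apply_left {n d : ℕ} {S T : Finset (Fin n)} (x : Config d S) (y : Config d T)
    (z : {s // s ∉ S ∪ T} → Fin d) (s : {s // s ∈ S}) : glue S T x y z s = x s := by
  simp [glue]

theorem glue_apply_right {n d : ℕ} {S T : Finset (Fin n)} (h : Disjoint S T) (x : Config d S)
    (y : Config d T) (z : {s // s ∉ S ∪ T} → Fin d) (s : {s // s ∈ T}) :
    glue S T x y z s = y s := by
  simp [glue, Finset.disjoint_right.1 h s.2]

theorem glue_apply_outer {n d : ℕ} {S T : Finset (Fin n)} (x : Config d S)
    (y : Config d T) (z : {s // s ∉ S ∪ T} → Fin d) (s : {s // s ∉ S ∪ T}) :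
    glue S T x y z s = z s := by
  have h := s.2
  rw [Finset.mem_union, not_or] at h
  simp [glue, h.1, h.2]

theorem glue_eq_zero_of_left_right {ψ : (Fin n → Fin d) → ℂ} (hψ : AtMostOneExcitation ψ)
    {S T : Finset (Fin n)} (h : Disjoint S T) {x : Config d S} {y : Config d T}
    (z : {s // s ∉ S ∪ T} → Fin d) (hx : x ≠ 0) (hy : y ≠ 0) : ψ (glue S T x y z) = 0 := by
  obtain ⟨s, hs⟩ := Function.ne_iff.1 hx
  obtain ⟨t, ht⟩ := Function.ne_iff.1 hy
  refine hψ _ s t (fun e ↦ Finset.disjoint_left.1 h s.2 (e ▸ t.2)) ?_ ?_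
  · rwa [glue_apply_left]
  · rwa [glue_apply_right h]

theorem glue_eq_zero_of_outer {ψ : (Fin n → Fin d) → ℂ} (hψ : AtMostOneExcitation ψ)
    {S T : Finset (Fin n)} (h : Disjoint S T) {x : Config d S × Config d T}
    {z : {s // s ∉ S ∪ T} → Fin d} (hx : x ≠ (0, 0)) (hz : z ≠ 0) :
    ψ (glue S T x.1 x.2 z) = 0 := by
  obtain ⟨u, hu⟩ := Function.ne_iff.1 hz
  have hx' : x.1 ≠ 0 ∨ x.2 ≠ 0 := by
    by_contra! hc
    exact hx (Prod.ext hc.1 hc.2)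
  rcases hx' with hx | hx
  · obtain ⟨s, hs⟩ := Function.ne_iff.1 hx
    refine hψ _ s u (fun e ↦ u.2 (e ▸ Finset.mem_union_left _ s.2)) ?_ ?_
    · rwa [glue_apply_left]
    · rwa [glue_apply_outer]
  · obtain ⟨s, hs⟩ := Function.ne_iff.1 hx
    refine hψ _ s u (fun e ↦ u.2 (e ▸ Finset.mem_union_right _ s.2)) ?_ ?_
    · rwa [glue_apply_right h]
    · rwa [glue_apply_outer]

/-- The environment state `z = 0` gives the coherent term. An excited environment forces `S ∪ T`
into the vacuum, and these terms add up to the outside weight. -/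
theorem reducedState_eq_addVacuum {ψ : (Fin n → Fin d) → ℂ} (hψ : AtMostOneExcitation ψ)
    {S T : Finset (Fin n)} (h : Disjoint S T) :
    reducedState ψ S T = addVacuum (fun x ↦ ψ (glue S T x.1 x.2 0)) (0, 0)
      (excitationWeight ψ (Finset.univ.filter (· ∉ S ∪ T))) := by
  ext x y
  simp only [reducedState, addVacuum, Matrix.of_apply]
  rw [← Finset.add_sum_erase _ _ (Finset.mem_univ 0), ← Finset.filter_ne']
  congr 1
  split_ifs with hxy
  · rw [hxy.1, hxy.2, ← sum_extendZero hψ]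
    push_cast
    refine Finset.sum_congr rfl fun z _ ↦ ?_
    simp only [glue_zero_left]
    simp [Complex.mul_conj, Complex.normSq_eq_norm_sq]
  · refine Finset.sum_eq_zero fun z hz ↦ ?_
    have hz := (Finset.mem_filter.1 hz).2
    rw [not_and_or] at hxy
    rcases hxy with hx | hy
    · rw [glue_eq_zero_of_outer hψ h hx hz, zero_mul]
    · rw [glue_eq_zero_of_outer hψ h hy hz, star_zero, mul_zero]

/-- The Rényi entanglement of the two-party reduced states of a superposition of at most one
excitation is a function of the concurrence `2 √(w_S w_T)`. -/
theorem entanglement_eq_concurrenceRenyi {α : ℝ} (hα : (√7 - 1) / 2 ≤ α)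
    {ψ : (Fin n → Fin d) → ℂ} (hψ : AtMostOneExcitation ψ) (hreal : (ψ 0).im = 0)
    (hnorm : ‖ψ 0‖ ^ 2 + excitationWeight ψ Finset.univ = 1)
    {S T : Finset (Fin n)} (h : Disjoint S T) :
    entanglement α ψ S T
      = concurrenceRenyi α √(4 * excitationWeight ψ S * excitationWeight ψ T) := by
  have hS : ∑ x : Config d S with x ≠ 0, ‖ψ (glue S T x 0 0)‖ ^ 2 = excitationWeight ψ S := by
    simp only [glue_zero_right]
    rw [sum_extendZero hψ]
    simp
  have hT : ∑ y : Config d T with y ≠ 0, ‖ψ (glue S T 0 y 0)‖ ^ 2 = excitationWeight ψ T := by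
    simp only [glue_zero_outer h]
    rw [sum_extendZero hψ]
    simp
  have h0 : glue S T (0 : Config d S) 0 0 = 0 := by
    rw [glue_zero_right]; ext s; simp [extendZero]
  have hsupp (x : Config d S) (y : Config d T) (hx : x ≠ 0) (hy : y ≠ 0) :
      ψ (glue S T x y 0) = 0 := glue_eq_zero_of_left_right hψ h 0 hx hy
  have hsplit : excitationWeight ψ Finset.univ = excitationWeight ψ S + excitationWeight ψ T
      + excitationWeight ψ (Finset.univ.filter (· ∉ S ∪ T)) := by
    rw [← excitationWeight_union ψ h, ← excitationWeight_union]
    · congr 1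
      ext s
      simp only [Finset.mem_univ, Finset.mem_union, Finset.mem_filter, true_and, true_iff]
      tauto
    · rw [Finset.disjoint_left]
      intro s hs
      simp only [Finset.mem_filter, not_and, not_not]
      exact fun _ ↦ hs
  have hn : ∑ x : Config d S × Config d T, ‖ψ (glue S T x.1 x.2 0)‖ ^ 2
      + excitationWeight ψ (Finset.univ.filter (· ∉ S ∪ T)) = 1 := by
    rw [sum_norm_sq_of_support (φ := fun x : Config d S × Config d T ↦ ψ (glue S T x.1 x.2 0))
      hsupp, hS, hT, h0]
    linarith
  unfold entanglement
  rw [reducedState_eq_addVacuum hψ h, renyiEntanglement_addVacuum hα hsupp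
    (excitationWeight_nonneg _ _) (by simpa only [h0] using hreal) hn, hS, hT, mul_assoc 4,
    Real.sqrt_mul (show (0 : ℝ) ≤ 4 by norm_num), show √(4 : ℝ) = 2 by
      rw [show (4 : ℝ) = 2 ^ 2 by norm_num]; exact Real.sqrt_sq (by norm_num)]

/-- Disjoint weights add, so `4 w_S w_(T ∪ U) = 4 w_S w_T + 4 w_S w_U`, and the superadditivity of
the squared convex function applies. -/
theorem entanglement_sq_add_sq_le {α : ℝ} (hα : (√7 - 1) / 2 ≤ α)
    {ψ : (Fin n → Fin d) → ℂ} (hψ : AtMostOneExcitation ψ) (hreal : (ψ 0).im = 0)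
    (hnorm : ‖ψ 0‖ ^ 2 + excitationWeight ψ Finset.univ = 1)
    {S T U : Finset (Fin n)} (hST : Disjoint S T) (hSU : Disjoint S U) (hTU : Disjoint T U) :
    entanglement α ψ S T ^ 2 + entanglement α ψ S U ^ 2 ≤ entanglement α ψ S (T ∪ U) ^ 2 := by
  have hα0 : 0 < α := by linarith [sqrt_seven_bounds.1]
  have hSTU : Disjoint S (T ∪ U) := Finset.disjoint_union_right.2 ⟨hST, hSU⟩
  have hle : excitationWeight ψ (S ∪ (T ∪ U)) ≤ excitationWeight ψ Finset.univ :=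
    Finset.sum_le_sum_of_subset_of_nonneg (Finset.subset_univ _) fun _ _ _ ↦
      Finset.sum_nonneg fun _ _ ↦ sq_nonneg _
  rw [excitationWeight_union ψ hSTU, excitationWeight_union ψ hTU] at hle
  rw [entanglement_eq_concurrenceRenyi hα hψ hreal hnorm hST,
    entanglement_eq_concurrenceRenyi hα hψ hreal hnorm hSU,
    entanglement_eq_concurrenceRenyi hα hψ hreal hnorm hSTU, excitationWeight_union ψ hTU,
    mul_add]
  have h1 := excitationWeight_nonneg ψ S
  have h2 := excitationWeight_nonneg ψ T
  have h3 := excitationWeight_nonneg ψ U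
  refine sq_add_sq_le_of_convexOn (convexOn_concurrenceRenyi hα)
    (concurrenceRenyi_zero hα0.ne') (fun x ↦ concurrenceRenyi_nonneg hα0)
    (by positivity) (by positivity) ?_
  have hs : excitationWeight ψ S + (excitationWeight ψ T + excitationWeight ψ U) ≤ 1 := by
    linarith [sq_nonneg ‖ψ 0‖]
  -- `4 w w' ≤ (w + w')² ≤ 1` keeps the squared concurrence within the convexity range.
  have := pow_le_one₀ (n := 2) (by positivity) hs
  nlinarith [sq_nonneg (excitationWeight ψ S - (excitationWeight ψ T + excitationWeight ψ U))]

end ReducedStates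

/-! ### The GWV state has at most one excitation and unit norm. -/

section GWV

variable {n d : ℕ} [NeZero d]

theorem genW_zero (a : Fin n → Fin d → ℂ) : genW a 0 = 0 := by
  refine Finset.sum_eq_zero fun s _ ↦ Finset.sum_eq_zero fun i hi ↦ if_neg fun h ↦ ?_
  have := congrFun h s
  rw [Pi.single_eq_same] at this
  exact (Finset.mem_filter.1 hi).2 this.symm

theorem genW_single (a : Fin n → Fin d → ℂ) (s : Fin n) {i : Fin d} (hi : i ≠ 0) :
    genW a (Pi.single s i) = a s i := by
  unfold genW
  rw [Fintype.sum_eq_single s, Finset.sum_eq_single_of_mem i (by simpa using hi), if_pos rfl]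
  · intro j _ hj
    exact if_neg fun h ↦ hj (Pi.single_injective s h).symm
  · intro t ht
    refine Finset.sum_eq_zero fun j _ ↦ if_neg fun h ↦ hi ?_
    have := congrFun h s
    rwa [Pi.single_eq_same, Pi.single_eq_of_ne ht.symm] at this

theorem atMostOneExcitation_gwv (p : ℝ) (a : Fin n → Fin d → ℂ) :
    AtMostOneExcitation (gwv p a) := by
  intro x s s' hss hs hs'
  have hx : x ≠ 0 := fun h ↦ hs (congrFun h s)
  have hW : genW a x = 0 := by
    refine Finset.sum_eq_zero fun t _ ↦ Finset.sum_eq_zero fun i _ ↦ if_neg fun h ↦ ?_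
    by_cases ht : s = t
    · rw [h, Pi.single_eq_of_ne (fun e ↦ hss (ht.trans e.symm))] at hs'
      exact hs' rfl
    · rw [h, Pi.single_eq_of_ne ht] at hs
      exact hs rfl
  simp [gwv, hW, hx]

theorem gwv_zero (p : ℝ) (a : Fin n → Fin d → ℂ) : gwv p a 0 = (√(1 - p) : ℂ) := by
  simp [gwv, genW_zero]

theorem excitationWeight_gwv_univ {p : ℝ} (hp : 0 ≤ p) (a : Fin n → Fin d → ℂ)
    (ha : ∑ s, ∑ i : Fin d with i ≠ 0, ‖a s i‖ ^ 2 = 1) :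
    excitationWeight (gwv p a) Finset.univ = p := by
  have : ∀ s, ∀ i : Fin d, i ≠ 0 → ‖gwv p a (Pi.single s i)‖ ^ 2 = p * ‖a s i‖ ^ 2 := by
    intro s i hi
    have hne : (Pi.single s i : Fin n → Fin d) ≠ 0 := by simpa using hi
    simp [gwv, genW_single a s hi, hne, mul_pow, Real.sq_sqrt hp]
  unfold excitationWeight
  rw [Finset.sum_congr rfl fun s _ ↦ Finset.sum_congr rfl fun i hi ↦
    this s i (Finset.mem_filter.1 hi).2]
  simp only [← Finset.mul_sum]
  rw [ha, mul_one]

end GWV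

end GWVState

end

/-! ### The weighted monogamy inequality. -/

theorem theorem10 (n d : ℕ) [NeZero d]
    -- the state `√p |W⟩ + √(1 - p) |0 … 0⟩` of `n` qudits of dimension `d`
    (p : ℝ) (hp0 : 0 ≤ p) (hp1 : p ≤ 1)
    (a : Fin n → Fin d → ℂ) (ha : ∑ s, ∑ i : Fin d with i ≠ 0, ‖a s i‖ ^ 2 = 1)
    -- the partition `{P, Q 0, …, Q (r - 1)}` of a set of qudits
    (r : ℕ) (P : Finset (Fin n)) (Q : Fin r → Finset (Fin n))
    (hP : P.Nonempty) (hQ : ∀ j, (Q j).Nonempty)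
    (hPQ : ∀ j, Disjoint P (Q j)) (hQQ : ∀ i j, i ≠ j → Disjoint (Q i) (Q j))
    (α β k : ℝ) (hα : (√7 - 1) / 2 ≤ α) (hβ : 2 ≤ β) (hk0 : 0 < k) (hk1 : k ≤ 1)
    (t : ℕ) (ht : t + 3 ≤ r)
    (hlow : ∀ i : Fin r, (i : ℕ) ≤ t →
      GWVState.entanglement α (GWVState.gwv p a) P ((Finset.univ.filter (i < ·)).biUnion Q) ^ 2
        ≤ k * GWVState.entanglement α (GWVState.gwv p a) P (Q i) ^ 2)
    (hhigh : ∀ j : Fin r, t + 1 ≤ (j : ℕ) → (j : ℕ) ≤ r - 2 →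
      GWVState.entanglement α (GWVState.gwv p a) P (Q j) ^ 2
        ≤ k * GWVState.entanglement α (GWVState.gwv p a) P
            ((Finset.univ.filter (j < ·)).biUnion Q) ^ 2) :
    (∑ j ∈ Finset.univ.filter (fun j : Fin r => (j : ℕ) ≤ t),
        GWVState.weight k β ^ (j : ℕ)
          * GWVState.entanglement α (GWVState.gwv p a) P (Q j) ^ β)
      + GWVState.weight k β ^ (t + 2)
          * (∑ j ∈ Finset.univ.filter (fun j : Fin r => t + 1 ≤ (j : ℕ) ∧ (j : ℕ) ≤ r - 2),
              GWVState.entanglement α (GWVState.gwv p a) P (Q j) ^ β)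
      + GWVState.weight k β ^ (t + 1)
          * GWVState.entanglement α (GWVState.gwv p a) P (Q ⟨r - 1, by omega⟩) ^ β
      ≤ GWVState.entanglement α (GWVState.gwv p a) P (Finset.univ.biUnion Q) ^ β := by
  have hk0' := GWVState.weight_nonneg hk0 hβ
  set ψ := GWVState.gwv p a with hψdef
  have hψ : GWVState.AtMostOneExcitation ψ := GWVState.atMostOneExcitation_gwv p a
  have hreal : (ψ 0).im = 0 := by rw [hψdef, GWVState.gwv_zero]; simp
  have hnorm : ‖ψ 0‖ ^ 2 + GWVState.excitationWeight ψ Finset.univ = 1 := by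
    rw [hψdef, GWVState.excitationWeight_gwv_univ hp0 a ha, GWVState.gwv_zero]
    simp [Real.sq_sqrt (sub_nonneg.2 hp1)]
  have hnn {T : Finset (Fin n)} (hT : Disjoint P T) : 0 ≤ GWVState.entanglement α ψ P T := by
    rw [GWVState.entanglement_eq_concurrenceRenyi hα hψ hreal hnorm hT]
    exact GWVState.concurrenceRenyi_nonneg (by linarith [GWVState.sqrt_seven_bounds.1])
  -- Indexing by all naturals makes `tail 0` the full union and `tail r` empty.
  let tail (m : ℕ) : Finset (Fin n) := (Finset.univ.filter (fun i : Fin r ↦ m ≤ i)).biUnion Q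
  have htail_disj (m : ℕ) : Disjoint P (tail m) :=
    (Finset.disjoint_biUnion_right _ _ _).2 fun i _ ↦ hPQ i
  have htail_succ (j : Fin r) :
      tail (j + 1) = (Finset.univ.filter (j < ·)).biUnion Q := by
    simp only [tail, Nat.succ_le_iff, Fin.lt_def]
  have htail_union (j : Fin r) : tail j = Q j ∪ tail (j + 1) := by
    simp only [tail]
    rw [← Finset.biUnion_insert]
    refine congrArg (Finset.biUnion · Q) (Finset.ext fun i ↦ ?_)
    simp only [Finset.mem_filter, Finset.mem_univ, true_and, Finset.mem_insert, Fin.ext_iff]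
    omega
  have hQtail (j : Fin r) : Disjoint (Q j) (tail (j + 1)) := by
    refine (Finset.disjoint_biUnion_right _ _ _).2 fun i hi ↦ hQQ j i fun h ↦ ?_
    have := (Finset.mem_filter.1 hi).2
    rw [← h] at this
    omega
  have hmono (j : Fin r) : GWVState.entanglement α ψ P (Q j) ^ 2
      + GWVState.entanglement α ψ P (tail (j + 1)) ^ 2
      ≤ GWVState.entanglement α ψ P (tail j) ^ 2 := by
    rw [htail_union j]
    exact GWVState.entanglement_sq_add_sq_le hα hψ hreal hnorm (hPQ j) (htail_disj _) (hQtail j)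
  let e (m : ℕ) : ℝ := if h : m < r then GWVState.entanglement α ψ P (Q ⟨m, h⟩) ^ β else 0
  let T (m : ℕ) : ℝ := GWVState.entanglement α ψ P (tail m) ^ β
  have he (j : Fin r) : GWVState.entanglement α ψ P (Q j) ^ β = e j := by simp [e]
  -- The last index is `r - 1`, so the default `0` of `e` beyond `r` is never reached and the middle
  -- sum ends at `r - 2`.
  have key := GWVState.weighted_sum_le (e := e) (T := T) hk0' (t := t) (l := r - 1) (by omega)
    ?_ ?_ ?_
  · have hsum (f : ℕ → ℝ) (q : ℕ → Prop) [DecidablePred q] :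
        ∑ j ∈ Finset.univ.filter (fun j : Fin r ↦ q j), f j
          = ∑ m ∈ (Finset.range r).filter q, f m := by
      rw [Finset.sum_filter, Finset.sum_filter, Fin.sum_univ_eq_sum_range
        (fun m ↦ if q m then f m else 0)]
    have h0 : tail 0 = Finset.univ.biUnion Q := by simp [tail]
    simp only [T, h0] at key
    simp only [he]
    rw [hsum (fun m ↦ GWVState.weight k β ^ m * e m) (· ≤ t),
      hsum e (fun m ↦ t + 1 ≤ m ∧ m ≤ r - 2)]
    have hr1 : (Finset.range r).filter (· ≤ t) = Finset.range (t + 1) := by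
      ext m; simp only [Finset.mem_filter, Finset.mem_range]; omega
    have hr2 : (Finset.range r).filter (fun m ↦ t + 1 ≤ m ∧ m ≤ r - 2)
        = Finset.Ico (t + 1) (r - 1) := by
      ext m; simp only [Finset.mem_filter, Finset.mem_range, Finset.mem_Ico]; omega
    rw [hr1, hr2]
    exact key
  · have hr : r - 1 < r := by omega
    -- The last tail dominates its only block: the square of the empty tail's entanglement is
    -- dropped.
    have := hmono ⟨r - 1, hr⟩
    rw [← he ⟨r - 1, hr⟩]
    refine Real.rpow_le_rpow (hnn (hPQ _)) ?_ (by linarith)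
    exact (sq_le_sq₀ (hnn (hPQ _)) (hnn (htail_disj _))).1 (le_of_add_le_of_nonneg_left this (sq_nonneg _))
  · intro m hm
    have hmr : m < r := by omega
    have hl := hlow ⟨m, hmr⟩ hm
    rw [← htail_succ] at hl
    have := GWVState.rpow_add_weight_mul_rpow_le hk0 hβ (hnn (hPQ ⟨m, hmr⟩))
      (hnn (htail_disj (m + 1))) (hnn (htail_disj m)) (hmono ⟨m, hmr⟩) hl
    rwa [he] at this
  · intro m hm1 hm2
    have hmr : m < r := by omega
    have hh := hhigh ⟨m, hmr⟩ hm1 (by simp only; omega)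
    rw [← htail_succ] at hh
    have hm' := hmono ⟨m, hmr⟩
    -- Above `t` the tail is the dominant term, so the weight falls on the single block instead.
    rw [add_comm] at hm'
    have := GWVState.rpow_add_weight_mul_rpow_le hk0 hβ (hnn (htail_disj (m + 1)))
      (hnn (hPQ ⟨m, hmr⟩)) (hnn (htail_disj m)) hm' hh
    rw [he] at this
    linarith
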